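/- Let $n\ge 0$, let $V$ be the $\mathbb C(q)$-vector space with basis $X_1,\dots,X_n$, and put $X_{ij}=X_i\otimes X_j$. Let $T:V\otimes V\to V\otimes V$ be the linear map with $T(X_{ii})=q^{-1}X_{ii}$ and, for $i<j$, $T(X_{ij})=X_{ji}$, $T(X_{ji})=X_{ij}-(q-q^{-1})X_{ji}$ (the normalized braiding of the standard $U_q(\mathfrak{sl}_n)$-module). Let $\Psi_i$ ($i=1,2,3$) be $T$ acting in the $i$-th and $(i+1)$-st factors of $V^{\otimes 4}$, let $$\Psi=\Psi_2\Psi_1\Psi_3\Psi_2+(q-q^{-1})(\Psi_1\Psi_2\Psi_1+\Psi_1\Psi_3\Psi_2)+(q-q^{-1})^2\Psi_1\Psi_2,$$ and let $S_q(V\otimes V)=T(V\otimes V)/\langle(\Psi-1)(V^{\otimes 4})\rangle$, the quotient of the tensor algebra of $V\otimes V$. Let $S(V\otimes V)=\mathbb C[X_{ij}:1\le i,j\le n]$. (1) There is exactly one skew-symmetric biderivation $\{\cdot,\cdot\}$ of $S(V\otimes V)$ such that, for all $1\le i\le j\le k\le l\le n$, \begin{align*} \{X_{ij},X_{kl}\}&=(\delta_{ik}+\delta_{il}+\delta_{jk}+\delta_{jl})X_{ij}X_{kl}-2(X_{il}X_{kj}+X_{ki}X_{lj}),\\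 \{X_{ij},X_{lk}\}&=(\delta_{ik}+\delta_{il}+\delta_{jk}+\delta_{jl})X_{ij}X_{lk}-2(X_{kj}X_{li}+X_{ik}X_{lj}),\\ \{X_{ji},X_{kl}\}&=(\delta_{ik}+\delta_{il}+\delta_{jk}+\delta_{jl})X_{ji}X_{kl}-2(X_{jl}X_{ki}+X_{kj}X_{li}),\\ \{X_{ji},X_{lk}\}&=(\delta_{ik}+\delta_{il}+\delta_{jk}+\delta_{jl})X_{ji}X_{lk}-2(X_{jk}X_{li}+X_{ki}X_{lj}),\\ \{X_{ik},X_{jl}\}&=(\delta_{ij}+\delta_{il}-\delta_{jk}+\delta_{kl})X_{ik}X_{jl}-2(X_{il}X_{jk}-X_{ij}X_{kl}+X_{ji}X_{lk}),\\ \{X_{ik},X_{lj}\}&=(\delta_{ij}+\delta_{il}-\delta_{jk}+\delta_{kl})X_{ik}X_{lj}-2X_{jk}X_{li},\\ \{X_{ki},X_{jl}\}&=(\delta_{ij}+\delta_{il}-\delta_{jk}+\delta_{kl})X_{jl}X_{ki}-2X_{jk}X_{li},\\ \{X_{ki},X_{lj}\}&=(\delta_{ij}+\delta_{il}-\delta_{jk}+\delta_{kl})X_{ki}X_{lj}-2X_{kj}X_{li},\\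 \{X_{il},X_{jk}\}&=(\delta_{ij}+\delta_{ik}-\delta_{jl}-\delta_{kl})X_{il}X_{jk}+2(X_{ij}X_{lk}-X_{ji}X_{kl}),\\ \{X_{il},X_{kj}\}&=(\delta_{ij}+\delta_{ik}-\delta_{jl}-\delta_{kl})X_{il}X_{kj}+2(X_{ik}X_{lj}-X_{jl}X_{ki}),\\ \{X_{li},X_{kj}\}&=(\delta_{ij}+\delta_{ik}-\delta_{jl}-\delta_{kl})X_{kj}X_{li},\\ \{X_{li},X_{jk}\}&=(\delta_{ij}+\delta_{ik}-\delta_{jl}-\delta_{kl})X_{jk}X_{li}, \end{align*} and it is a Poisson bracket. (2) It is the classical limit of $S_q(V\otimes V)$: for every total order on the $X_{ij}$, the ordered monomials in the $X_{ij}$ form a basis of $S_q(V\otimes V)$ over $\mathbb C(q)$; and if $\mathcal A\subset S_q(V\otimes V)$ is the subalgebra generated by the $X_{ij}$ over the ring of rational functions of $q$ that are defined at $q=1$, then there is a ring homomorphism $\pi:\mathcal A\to S(V\otimes V)$ with kernel $(q-1)\mathcal A$, with $\pi(X_{ij})=X_{ij}$, and with $\pi(f)=f(1)$ for scalars $f$,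 such that $\{\pi(a),\pi(b)\}=\pi\big(\tfrac{ba-ab}{q-1}\big)$ for all $a,b\in\mathcal A$. (3) The bracket lifts the Goodearl–Yakimov brackets on $S(S^2V)$ and $S(\Lambda^2V)$. That is, the ideals of $S(V\otimes V)$ generated by $\Lambda^2V=\operatorname{Span}\{X_{ij}-X_{ji}\}$ and by $S^2V=\operatorname{Span}\{X_{ij}+X_{ji}\}$ are Poisson ideals. They are the kernels of the surjections $X_{ij}\mapsto Y_{ij}$ of $S(V\otimes V)$ onto $S(S^2V)$, the polynomial algebra in the variables $Y_{ij}=Y_{ji}$ ($i\le j$), respectively onto $S(\Lambda^2V)$, the polynomial algebra in the variables $Y_{ij}=-Y_{ji}$ ($i<j$). In both cases the Poisson bracket induced on the quotient is given, for all $i,j,k,l$, by $$\{Y_{ij},Y_{kl}\}=(\operatorname{sgn}(i-k)+\operatorname{sgn}(j-l))\,Y_{il}Y_{kj}+(\operatorname{sgn}(i-l)+\operatorname{sgn}(j-k))\,Y_{ik}Y_{jl}.$$ -/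

import Mathlib

open scoped TensorProduct

noncomputable section

namespace QuantumFolding

/-! ### The ground field and its local subring at `q = 1` -/

/-- The field `ℂ(q)`. -/
abbrev Cq : Type := RatFunc ℂ

/-- The indeterminate `q`. -/
def q : Cq := RatFunc.X

/-- The rational functions in `q` that are defined at `q = 1`. -/
def regularAtOne : Subring Cq where
  carrier := {f | f.denom.eval 1 ≠ 0}
  mul_mem' {f g} hf hg h := by
    have := Polynomial.eval_eq_zero_of_dvd_of_eval_eq_zero (RatFunc.denom_mul_dvd f g) h
    rw [Polynomial.eval_mul] at this
    exact (mul_ne_zero hf hg) this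
  one_mem' := by simp
  add_mem' {f g} hf hg h := by
    have := Polynomial.eval_eq_zero_of_dvd_of_eval_eq_zero (RatFunc.denom_add_dvd f g) h
    rw [Polynomial.eval_mul] at this
    exact (mul_ne_zero hf hg) this
  zero_mem' := by simp
  neg_mem' {f} hf h := by
    have hd : (-f).denom ∣ f.denom := by
      rw [RatFunc.denom_dvd f.denom_ne_zero]
      exact ⟨-f.num, by rw [map_neg, neg_div, RatFunc.num_div_denom]⟩
    exact hf (Polynomial.eval_eq_zero_of_dvd_of_eval_eq_zero hd h)

/-- The value at `q = 1` of a rational function (used for those that are defined there). -/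
def valueAtOne (f : Cq) : ℂ := f.eval (RingHom.id ℂ) 1

/-- The element `q - 1` of the local ring. -/
def qSubOne : regularAtOne :=
  ⟨q - 1, by
    have h : (q - 1 : Cq) = algebraMap (Polynomial ℂ) Cq (Polynomial.X - 1) := by
      simp [q]
    change (q - 1 : Cq).denom.eval 1 ≠ 0
    rw [h, RatFunc.denom_algebraMap]
    simp⟩

/-! ### The module `V`, the braiding `T` on `V ⊗ V`, and `Ψ` on `(V ⊗ V) ⊗ (V ⊗ V)` -/

/-- The underlying space of the standard `n`-dimensional module, with its standard basis
`v i = Pi.single i 1`. -/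
abbrev V (n : ℕ) : Type := Fin n → Cq

/-- The basis `X i j = v i ⊗ v j` of `V ⊗ V`. -/
def basisVV (n : ℕ) : Module.Basis (Fin n × Fin n) Cq (V n ⊗[Cq] V n) :=
  (Pi.basisFun Cq (Fin n)).tensorProduct (Pi.basisFun Cq (Fin n))

/-- The normalized braiding `T` of `V` with itself (with `(T - q⁻¹) (T + q) = 0`):
`T (X i i) = q⁻¹ X i i`, and for `i < j`,
`T (X i j) = X j i` and `T (X j i) = X i j - (q - q⁻¹) X j i`. -/
def T (n : ℕ) : V n ⊗[Cq] V n →ₗ[Cq] V n ⊗[Cq] V n :=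
  (basisVV n).constr Cq fun p =>
    if p.1 = p.2 then q⁻¹ • basisVV n p
    else if p.1 < p.2 then basisVV n (p.2, p.1)
    else basisVV n (p.2, p.1) - (q - q⁻¹) • basisVV n p

/-- `V^{⊗4}`, bracketed as `(V ⊗ V) ⊗ (V ⊗ V)`. -/
abbrev V4 (n : ℕ) : Type := (V n ⊗[Cq] V n) ⊗[Cq] (V n ⊗[Cq] V n)

/-- The rebracketing `(a ⊗ b) ⊗ (c ⊗ d) ↦ a ⊗ ((b ⊗ c) ⊗ d)`. -/
def middle (n : ℕ) : V4 n ≃ₗ[Cq] V n ⊗[Cq] ((V n ⊗[Cq] V n) ⊗[Cq] V n) :=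
  (TensorProduct.assoc Cq (V n) (V n) (V n ⊗[Cq] V n)).trans
    (TensorProduct.congr (LinearEquiv.refl Cq (V n))
      (TensorProduct.assoc Cq (V n) (V n) (V n)).symm)

/-- `T` in the tensor factors 1 and 2. -/
def Psi1 (n : ℕ) : Module.End Cq (V4 n) := TensorProduct.map (T n) LinearMap.id

/-- `T` in the tensor factors 2 and 3. -/
def Psi2 (n : ℕ) : Module.End Cq (V4 n) :=
  (middle n).symm.toLinearMap ∘ₗ
    TensorProduct.map LinearMap.id (TensorProduct.map (T n) LinearMap.id) ∘ₗ
      (middle n).toLinearMap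

/-- `T` in the tensor factors 3 and 4. -/
def Psi3 (n : ℕ) : Module.End Cq (V4 n) := TensorProduct.map LinearMap.id (T n)

/-- The operator `Ψ` (products in `Module.End` are compositions). -/
def Psi (n : ℕ) : Module.End Cq (V4 n) :=
  Psi2 n * Psi1 n * Psi3 n * Psi2 n
    + (q - q⁻¹) • (Psi1 n * Psi2 n * Psi1 n + Psi1 n * Psi3 n * Psi2 n)
    + (q - q⁻¹) ^ 2 • (Psi1 n * Psi2 n)

/-! ### The quadratic algebra `S_q(V ⊗ V) = T(V ⊗ V) / ⟨(Ψ - 1)(V^{⊗4})⟩` -/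

/-- The inclusion of `(V ⊗ V) ⊗ (V ⊗ V)` in the tensor algebra of `V ⊗ V`, as its part of
degree two: `x ⊗ y ↦ x y`. -/
def degTwo (n : ℕ) : V4 n →ₗ[Cq] TensorAlgebra Cq (V n ⊗[Cq] V n) :=
  TensorProduct.lift ((LinearMap.mul Cq (TensorAlgebra Cq (V n ⊗[Cq] V n))).compl₁₂
    (TensorAlgebra.ι Cq) (TensorAlgebra.ι Cq))

/-- The defining relations `Ψ y = y` of `S_q(V ⊗ V)`, for `y` in `V^{⊗4}`. -/
inductive SqRel (n : ℕ) :
    TensorAlgebra Cq (V n ⊗[Cq] V n) → TensorAlgebra Cq (V n ⊗[Cq] V n) → Prop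
  | mk (y : V4 n) : SqRel n (degTwo n (Psi n y)) (degTwo n y)

/-- The algebra `S_q(V ⊗ V)` over `ℂ(q)`. -/
abbrev Sq (n : ℕ) : Type := RingQuot (SqRel n)

/-- The generator `X i j` of `S_q(V ⊗ V)`. -/
def x (n : ℕ) (p : Fin n × Fin n) : Sq n :=
  RingQuot.mkAlgHom Cq (SqRel n) (TensorAlgebra.ι Cq (basisVV n p))

/-! ### Classical limits -/

/-- The ordered monomial with exponents `m` in the elements `x i`, where the finite index set is
ordered by the enumeration `e`. -/
def orderedMonomial {ι A : Type} [Monoid A] {N : ℕ} (e : Fin N ≃ ι) (x : ι → A) (m : ι → ℕ) : A :=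
  (List.ofFn fun k : Fin N => x (e k) ^ m (e k)).prod

/-- The ordered monomials in the `x i` form a basis of the `ℂ(q)`-algebra `A`. -/
def IsPBW {ι A : Type} [Ring A] [Algebra Cq A] {N : ℕ} (e : Fin N ≃ ι) (x : ι → A) : Prop :=
  LinearIndependent Cq (orderedMonomial e x) ∧
    Submodule.span Cq (Set.range (orderedMonomial e x)) = ⊤

/-- The integral form of `A`: the subalgebra generated by the `x i` over the ring of rational
functions that are defined at `q = 1`. -/
abbrev integralForm {ι A : Type} [Ring A] [Algebra Cq A] (x : ι → A) :
    Subalgebra regularAtOne A :=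
  Algebra.adjoin regularAtOne (Set.range x)

/-- The polynomial algebra `ℂ[X i]` is the classical limit of `A`: setting `q = 1` in the integral
form gives `ℂ[X i]`, with `x i` specializing to `X i`; and `br` is the bracket induced on it by the
commutator, in the sense that `br (π a) (π b)` is the specialization of `(b a - a b) / (q - 1)`.
The quotient `c` below exists, since `ℂ[X i]` is commutative, and is unique once `A` has a
basis. -/
def IsClassicalLimit {ι A : Type} [Ring A] [Algebra Cq A] (x : ι → A)
    (br : MvPolynomial ι ℂ →ₗ[ℂ] MvPolynomial ι ℂ →ₗ[ℂ] MvPolynomial ι ℂ) : Prop :=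
  ∃ π : integralForm x →+* MvPolynomial ι ℂ,
    (∀ f : regularAtOne,
      π (algebraMap regularAtOne (integralForm x) f) = MvPolynomial.C (valueAtOne f)) ∧
    (∀ i, π ⟨x i, Algebra.subset_adjoin (Set.mem_range_self i)⟩ = MvPolynomial.X i) ∧
    (∀ a, π a = 0 ↔ ∃ b, a = qSubOne • b) ∧
    ∀ a b c : integralForm x, b * a - a * b = qSubOne • c → br (π a) (π b) = π c

/-! ### Poisson brackets -/

/-- A skew-symmetric bilinear bracket that satisfies the Leibniz rule. -/
structure IsSkewBiderivation {P : Type} [CommRing P] [Algebra ℂ P]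
    (br : P →ₗ[ℂ] P →ₗ[ℂ] P) : Prop where
  skew : ∀ a b, br a b = -br b a
  leibniz : ∀ a b c, br a (b * c) = br a b * c + b * br a c

/-- A Poisson bracket: a skew biderivation that satisfies the Jacobi identity. -/
structure IsPoissonBracket {P : Type} [CommRing P] [Algebra ℂ P]
    (br : P →ₗ[ℂ] P →ₗ[ℂ] P) : Prop extends IsSkewBiderivation br where
  jacobi : ∀ a b c, br a (br b c) + br b (br c a) + br c (br a b) = 0

/-! ### The bracket on `S(V ⊗ V)` -/

/-- `S(V ⊗ V)`, as the polynomial algebra in the `X i j = X i ⊗ X j`. -/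
abbrev SVV (n : ℕ) : Type := MvPolynomial (Fin n × Fin n) ℂ

/-- The variable `X i j`. -/
abbrev X {n : ℕ} (i j : Fin n) : SVV n := MvPolynomial.X (i, j)

/-- Kronecker's symbol. -/
def δ {n : ℕ} (i j : Fin n) : SVV n := if i = j then 1 else 0

/-- The list of quadratic formulae for the brackets of the variables. -/
def QuadraticFormulae (n : ℕ) (br : SVV n →ₗ[ℂ] SVV n →ₗ[ℂ] SVV n) : Prop :=
  ∀ i j k l : Fin n, i ≤ j → j ≤ k → k ≤ l →
    br (X i j) (X k l) = (δ i k + δ i l + δ j k + δ j l) * (X i j * X k l)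
      - 2 * (X i l * X k j + X k i * X l j) ∧
    br (X i j) (X l k) = (δ i k + δ i l + δ j k + δ j l) * (X i j * X l k)
      - 2 * (X k j * X l i + X i k * X l j) ∧
    br (X j i) (X k l) = (δ i k + δ i l + δ j k + δ j l) * (X j i * X k l)
      - 2 * (X j l * X k i + X k j * X l i) ∧
    br (X j i) (X l k) = (δ i k + δ i l + δ j k + δ j l) * (X j i * X l k)
      - 2 * (X j k * X l i + X k i * X l j) ∧
    br (X i k) (X j l) = (δ i j + δ i l - δ j k + δ k l) * (X i k * X j l)
      - 2 * (X i l * X j k - X i j * X k l + X j i * X l k) ∧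
    br (X i k) (X l j) = (δ i j + δ i l - δ j k + δ k l) * (X i k * X l j)
      - 2 * (X j k * X l i) ∧
    br (X k i) (X j l) = (δ i j + δ i l - δ j k + δ k l) * (X j l * X k i)
      - 2 * (X j k * X l i) ∧
    br (X k i) (X l j) = (δ i j + δ i l - δ j k + δ k l) * (X k i * X l j)
      - 2 * (X k j * X l i) ∧
    br (X i l) (X j k) = (δ i j + δ i k - δ j l - δ k l) * (X i l * X j k)
      + 2 * (X i j * X l k - X j i * X k l) ∧
    br (X i l) (X k j) = (δ i j + δ i k - δ j l - δ k l) * (X i l * X k j)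
      + 2 * (X i k * X l j - X j l * X k i) ∧
    br (X l i) (X k j) = (δ i j + δ i k - δ j l - δ k l) * (X k j * X l i) ∧
    br (X l i) (X j k) = (δ i j + δ i k - δ j l - δ k l) * (X j k * X l i)

/-! ### The Goodearl-Yakimov brackets on `S(S²V)` and `S(Λ²V)` -/

/-- `S(S²V)`: polynomials in the variables `Y i j = Y j i`. -/
abbrev SSym (n : ℕ) : Type := MvPolynomial (Sym2 (Fin n)) ℂ

/-- The coordinate `Y i j` on symmetric matrices. -/
def symY {n : ℕ} (i j : Fin n) : SSym n := MvPolynomial.X s(i, j)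

/-- `S(Λ²V)`: polynomials in the variables `Y i j` with `i < j`. -/
abbrev SAlt (n : ℕ) : Type := MvPolynomial {p : Fin n × Fin n // p.1 < p.2} ℂ

/-- The coordinate `Y i j = - Y j i` on skew-symmetric matrices. -/
def altY {n : ℕ} (i j : Fin n) : SAlt n :=
  if h : i < j then MvPolynomial.X ⟨(i, j), h⟩
  else if h : j < i then -MvPolynomial.X ⟨(j, i), h⟩
  else 0

/-- The sign of `i - j`. -/
def sgn {n : ℕ} (i j : Fin n) : ℂ := if j < i then 1 else if i < j then -1 else 0

/-- The Goodearl-Yakimov formula for the brackets of the coordinates `Y i j`; it has the same shape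
for symmetric and for skew-symmetric matrices. -/
def GYFormula {n : ℕ} {P : Type} [CommRing P] [Algebra ℂ P] (Y : Fin n → Fin n → P)
    (br : P →ₗ[ℂ] P →ₗ[ℂ] P) : Prop :=
  ∀ i j k l : Fin n, br (Y i j) (Y k l) =
    (sgn i k + sgn j l) • (Y i l * Y k j) + (sgn i l + sgn j k) • (Y i k * Y j l)

/-- The projection `S(V ⊗ V) → S(S²V)`. -/
def toSym (n : ℕ) : SVV n →ₐ[ℂ] SSym n := MvPolynomial.aeval fun p => symY p.1 p.2

/-- The projection `S(V ⊗ V) → S(Λ²V)`. -/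
def toAlt (n : ℕ) : SVV n →ₐ[ℂ] SAlt n := MvPolynomial.aeval fun p => altY p.1 p.2

/-- The ideal of `S(V ⊗ V)` generated by `Λ²V`, the span of the `X i j - X j i`. -/
def idealAlt (n : ℕ) : Ideal (SVV n) :=
  Ideal.span (Set.range fun p : Fin n × Fin n => X p.1 p.2 - X p.2 p.1)

/-- The ideal of `S(V ⊗ V)` generated by `S²V`, the span of the `X i j + X j i`. -/
def idealSym (n : ℕ) : Ideal (SVV n) :=
  Ideal.span (Set.range fun p : Fin n × Fin n => X p.1 p.2 + X p.2 p.1)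

/-- A Poisson ideal for the bracket `br`. -/
def IsPoissonIdeal {P : Type} [CommRing P] [Algebra ℂ P] (br : P →ₗ[ℂ] P →ₗ[ℂ] P)
    (I : Ideal P) : Prop :=
  ∀ a ∈ I, ∀ b, br a b ∈ I

/-- The bracket `br` on `P` lifts the bracket `br'` on the quotient `Q` of `P`. -/
def Lifts {P Q : Type} [CommRing P] [Algebra ℂ P] [CommRing Q] [Algebra ℂ Q] (φ : P →ₐ[ℂ] Q)
    (br : P →ₗ[ℂ] P →ₗ[ℂ] P) (br' : Q →ₗ[ℂ] Q →ₗ[ℂ] Q) : Prop :=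
  Function.Surjective φ ∧ ∀ a b, φ (br a b) = br' (φ a) (φ b)

end QuantumFolding

end

noncomputable section

namespace QuantumFolding

/-! ### Braid relations between commuting families of half twists -/

section Braid

variable {G : Type*} [Group G]

/-! Transpose everything to functions of words in the letters of `V`, and let `T₁`, `T₂`, `T₃` be
the transposed braidings of four adjacent letters. Since `T⁻¹ = T + (q - q⁻¹)`, the four terms of
`Ψ` combine: its transpose is `T₂ T₃⁻¹ T₁ T₂⁻¹ = b⁻¹ a`, where `a = T₂ T₁ T₂⁻¹` braids the first
letters of two adjacent pairs and `b = T₂ T₃ T₂⁻¹` braids the second ones. A function `f` of words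
therefore defines a functional on `S_q(V ⊗ V)` as soon as `a i f = b i f` for all neighbouring
pairs.

In the braid group the twists of the even strands and those of the odd strands form two commuting
families, each satisfying the braid relations. Conjugation preserves the quadratic Hecke relation,
and two commuting solutions of it satisfy `(a i - b i) (a i * b i + 1) = 0`. Hence the sum of the
lifts of all permutations, written in the `u i = a i * b i`, is annihilated from the left by every
`a i - b i` (`sub_mul_symmetrizer`). Symmetrizing coordinate functions thus yields functionals. They
take values in the local ring at `q = 1` on words, and at `q = 1` the symmetrizer becomes the sum
over honest permutations of pairs, so the functional of a word `b` specializes to a nonzero multiple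
of the indicator of the rearrangements of `b`.

The rest is a general argument about `IsDeformation`: generators commuting modulo `q - 1`, with
quadratic corrections, and having such functionals. The functionals give independence of ordered
monomials (a determinant over the local ring is nonzero at `q = 1`); Nakayama's lemma in each degree
gives spanning. The functionals also show that specialization from the free algebra to polynomials
descends to the integral form, with kernel generated by `q - 1`. Its commutator divided by `q - 1`
induces the bracket, so skewness, the Leibniz rule and the Jacobi identity come from the commutator
and need no computation with the formulae.

On the variables the bracket is read off from the first order term of `Ψ` at `q = 1`, which gives
the uniform expression `genBracket`; the listed formulae are its values on sorted indices. Modulo `X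
i j = ± X j i` this expression becomes the Goodearl-Yakimov formula, whose symmetry makes the two
ideals Poisson. -/

/-- The half twist of the strands `2 i` and `2 i + 2`. -/
def evenTwist (s : ℕ → G) (i : ℕ) : G := s (2 * i + 1) * s (2 * i) * (s (2 * i + 1))⁻¹

/-- The half twist of the strands `2 i + 1` and `2 i + 3`. -/
def oddTwist (s : ℕ → G) (i : ℕ) : G := s (2 * i + 1) * s (2 * i + 2) * (s (2 * i + 1))⁻¹

/-- The relations of the braid group on infinitely many strands. -/
structure IsBraid {M : Type*} [Mul M] (s : ℕ → M) : Prop where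
  braid : ∀ i, s i * s (i + 1) * s i = s (i + 1) * s i * s (i + 1)
  comm : ∀ i j, i + 2 ≤ j → Commute (s i) (s j)

theorem conj_eq_of_braid {a b : G} (h : a * b * a = b * a * b) :
    a * b * a⁻¹ = b⁻¹ * a * b := by
  rw [mul_inv_eq_iff_eq_mul, mul_assoc, mul_assoc, eq_inv_mul_iff_mul_eq, ← mul_assoc, ← mul_assoc,
    h]

theorem braid_conj {a b g : G} (h : a * b * a = b * a * b) :
    (g * a * g⁻¹) * (g * b * g⁻¹) * (g * a * g⁻¹) =
      (g * b * g⁻¹) * (g * a * g⁻¹) * (g * b * g⁻¹) := by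
  have : ∀ x y z : G, (g * x * g⁻¹) * (g * y * g⁻¹) * (g * z * g⁻¹) = g * (x * y * z) * g⁻¹ := by
    intros; group
  rw [this, this, h]

theorem conj_eq_self {a g : G} (h : g * a = a * g) : g * a * g⁻¹ = a := by
  rw [h, mul_inv_cancel_right]

variable {s : ℕ → G}

theorem evenTwist_eq (hs : IsBraid s) (i : ℕ) :
    evenTwist s i = (s (2 * i))⁻¹ * s (2 * i + 1) * s (2 * i) :=
  conj_eq_of_braid (hs.braid (2 * i)).symm

theorem oddTwist_eq (hs : IsBraid s) (i : ℕ) :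
    oddTwist s i = (s (2 * i + 2))⁻¹ * s (2 * i + 1) * s (2 * i + 2) :=
  conj_eq_of_braid (hs.braid (2 * i + 1))

/-- Neighbouring even twists are the images of `s (2 * i + 1)` and `s (2 * i + 2)` under one common
conjugation, by `s (2 * i + 3) * (s (2 * i))⁻¹`: each of the two factors moves one element of the
pair and commutes with the other. The braid relation is inherited. -/
theorem isBraid_evenTwist (hs : IsBraid s) : IsBraid (evenTwist s) where
  braid i := by
    have c1 : s (2 * i + 3) * evenTwist s i = evenTwist s i * s (2 * i + 3) := by
      have h1 : Commute (s (2 * i + 3)) (s (2 * i)) := (hs.comm _ _ (by omega)).symm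
      have h2 : Commute (s (2 * i + 3)) (s (2 * i + 1)) := (hs.comm _ _ (by omega)).symm
      exact ((h2.mul_right h1).mul_right h2.inv_right)
    have c2 : (s (2 * i))⁻¹ * s (2 * i + 2) * ((s (2 * i))⁻¹)⁻¹ = s (2 * i + 2) := by
      have h1 : Commute (s (2 * i)) (s (2 * i + 2)) := hs.comm _ _ (by omega)
      exact conj_eq_self h1.inv_left
    have h0 := braid_conj (g := (s (2 * i))⁻¹) (hs.braid (2 * i + 1))
    rw [show 2 * i + 1 + 1 = 2 * i + 2 by ring, c2, inv_inv, ← evenTwist_eq hs] at h0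
    have h1 := braid_conj (g := s (2 * i + 3)) h0
    rw [conj_eq_self c1] at h1
    exact h1
  comm i j hij := by
    have h (k l : ℕ) (hk : k ≤ 2 * i + 1) (hl : 2 * j ≤ l) : Commute (s k) (s l) :=
      hs.comm _ _ (by omega)
    have h' (k : ℕ) (hk : k ≤ 2 * i + 1) : Commute (s k) (evenTwist s j) :=
      ((h k _ hk (by omega)).mul_right (h k _ hk (by omega))).mul_right
        (h k _ hk (by omega)).inv_right
    exact ((h' _ le_rfl).mul_left (h' _ (by omega))).mul_left (h' _ le_rfl).inv_left

/-- As for the even twists, now with the pair `s (2 * i + 2)`, `s (2 * i + 3)` conjugated by `s (2 *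
i + 1) * (s (2 * i + 4))⁻¹`. -/
theorem isBraid_oddTwist (hs : IsBraid s) : IsBraid (oddTwist s) where
  braid i := by
    have c1 : s (2 * i + 1) * oddTwist s (i + 1) = oddTwist s (i + 1) * s (2 * i + 1) := by
      have h1 : Commute (s (2 * i + 1)) (s (2 * (i + 1) + 1)) := hs.comm _ _ (by omega)
      have h2 : Commute (s (2 * i + 1)) (s (2 * (i + 1) + 2)) := hs.comm _ _ (by omega)
      exact ((h1.mul_right h2).mul_right h1.inv_right)
    have c2 : (s (2 * i + 4))⁻¹ * s (2 * i + 2) * ((s (2 * i + 4))⁻¹)⁻¹ = s (2 * i + 2) := by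
      have h1 : Commute (s (2 * i + 4)) (s (2 * i + 2)) := (hs.comm _ _ (by omega)).symm
      exact conj_eq_self h1.inv_left
    have h0 := braid_conj (g := (s (2 * i + 4))⁻¹) (hs.braid (2 * i + 2))
    have e : (s (2 * i + 4))⁻¹ * s (2 * i + 2 + 1) * ((s (2 * i + 4))⁻¹)⁻¹ = oddTwist s (i + 1) := by
      rw [inv_inv, oddTwist_eq hs]; rfl
    rw [c2, e] at h0
    have h1 := braid_conj (g := s (2 * i + 1)) h0
    rw [conj_eq_self c1] at h1
    exact h1
  comm i j hij := by
    have h (k l : ℕ) (hk : k ≤ 2 * i + 2) (hl : 2 * j + 1 ≤ l) : Commute (s k) (s l) :=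
      hs.comm _ _ (by omega)
    have h' (k : ℕ) (hk : k ≤ 2 * i + 2) : Commute (s k) (oddTwist s j) :=
      ((h k _ hk (by omega)).mul_right (h k _ hk (by omega))).mul_right
        (h k _ hk (by omega)).inv_right
    exact ((h' _ (by omega)).mul_left (h' _ (by omega))).mul_left (h' _ (by omega)).inv_left

/-- Only overlapping twists matter. For `i = j` both are conjugates by `s (2 * i + 1)` of commuting
generators; for `i = j + 1` the second form of each twist shows both as conjugates by `(s (2 * j +
2))⁻¹` of commuting generators. -/
theorem commute_evenTwist_oddTwist (hs : IsBraid s) (i j : ℕ) :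
    Commute (evenTwist s i) (oddTwist s j) := by
  rcases lt_trichotomy i j with hij | rfl | hij
  · have h (k l : ℕ) (hk : k ≤ 2 * i + 1) (hl : 2 * j + 1 ≤ l) : Commute (s k) (s l) :=
      hs.comm _ _ (by omega)
    have h' (k : ℕ) (hk : k ≤ 2 * i + 1) : Commute (s k) (oddTwist s j) :=
      ((h k _ hk (by omega)).mul_right (h k _ hk (by omega))).mul_right
        (h k _ hk (by omega)).inv_right
    exact ((h' _ (by omega)).mul_left (h' _ (by omega))).mul_left (h' _ (by omega)).inv_left
  · have h : Commute (s (2 * i)) (s (2 * i + 2)) := hs.comm _ _ (by omega)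
    exact (Commute.conj_iff _).2 h
  · obtain rfl | hij' : i = j + 1 ∨ j + 2 ≤ i := by omega
    · have h : Commute (s (2 * j + 3)) (s (2 * j + 1)) := (hs.comm _ _ (by omega)).symm
      rw [evenTwist_eq hs, oddTwist_eq hs]
      have := (Commute.conj_iff (s (2 * j + 2))⁻¹).2 h
      rwa [inv_inv] at this
    · have h (k l : ℕ) (hk : 2 * i ≤ k) (hl : l ≤ 2 * j + 2) : Commute (s k) (s l) :=
        (hs.comm _ _ (by omega)).symm
      have h' (k : ℕ) (hk : 2 * i ≤ k) : Commute (s k) (oddTwist s j) :=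
        ((h k _ hk (by omega)).mul_right (h k _ hk (by omega))).mul_right
          (h k _ hk (by omega)).inv_right
      exact ((h' _ (by omega)).mul_left (h' _ (by omega))).mul_left (h' _ (by omega)).inv_left

end Braid

/-! ### The symmetrizer of a pair of commuting Hecke algebra actions -/

section Symmetrizer

variable {B : Type*} [Ring B]

/-- The sum `1 + u (d-1) + u (d-2) u (d-1) + ⋯ + u 0 ⋯ u (d-1)`. -/
def cosetSum (u : ℕ → B) : ℕ → B
  | 0 => 1
  | d + 1 => cosetSum u d * u d + 1

/-- The sum of the lifts of all permutations of `0, …, d`. -/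
def symmetrizer (u : ℕ → B) : ℕ → B
  | 0 => 1
  | d + 1 => cosetSum u (d + 1) * symmetrizer u d

variable {a b : ℕ → B} {h : B}

theorem commute_cosetSum {u : ℕ → B} {c : B} : ∀ {d : ℕ}, (∀ i < d, Commute c (u i)) →
    Commute c (cosetSum u d)
  | 0, _ => Commute.one_right c
  | d + 1, H =>
    ((commute_cosetSum fun i hi => H i (by omega)).mul_right (H d (by omega))).add_right
      (Commute.one_right c)

/-- The factor `cosetSum` runs over coset representatives of a smaller symmetric group in the next
one, and `C` plays the role of the smaller symmetrizer. For the last index, `hq` kills the terms `u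
d + 1`, while in the remaining terms `a d - b d` moves to the right, becomes `a (d - 1) - b (d - 1)`
and kills `C`. For a smaller index the summand `1` is killed by hypothesis, and induction applies
with `u d * C` in place of `C`. -/
theorem sub_mul_cosetSum_mul (ha : IsBraid a) (hb : IsBraid b)
    (hab : ∀ i j, Commute (a i) (b j))
    (hq : ∀ i, (a i - b i) * (a i * b i + 1) = 0) :
    ∀ (d : ℕ) (C : B), (∀ j, j + 1 < d → (a j - b j) * C = 0) →
      ∀ i < d, (a i - b i) * (cosetSum (fun k => a k * b k) d * C) = 0
  | 0, _, _, i, hi => by omega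
  | d + 1, C, hC, i, hi => by
    have hcu {i j : ℕ} (hij : i + 2 ≤ j) : Commute (a j - b j) (a i * b i) :=
      ((((ha.comm i j hij).symm).mul_right (hab j i)).sub_left
        ((hab i j).symm.mul_right (hb.comm i j hij).symm))
    have hcu' {i j : ℕ} (hij : i + 2 ≤ j) : Commute (a i - b i) (a j * b j) :=
      ((((ha.comm i j hij)).mul_right (hab i j)).sub_left
        ((hab j i).symm.mul_right (hb.comm i j hij)))
    rw [cosetSum, add_mul, one_mul, mul_add, mul_assoc]
    obtain rfl | hi' : i = d ∨ i < d := by omega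
    · cases i with
      | zero =>
        calc _ = (a 0 - b 0) * (a 0 * b 0 + 1) * C := by rw [cosetSum]; noncomm_ring
          _ = 0 := by rw [hq, zero_mul]
      | succ k =>
        -- Passing `u k * u (k + 1)` lowers the index by one: this is the braid relation in each
        -- family separately, the other family being a spectator.
        have key : (a (k + 1) - b (k + 1)) * ((a k * b k) * (a (k + 1) * b (k + 1))) =
            ((a k * b k) * (a (k + 1) * b (k + 1))) * (a k - b k) := by
          have e1 : (a k * b k) * (a (k + 1) * b (k + 1)) =
              (a k * a (k + 1)) * (b k * b (k + 1)) := by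
            rw [mul_assoc, ← mul_assoc (b k), ← (hab (k + 1) k).eq]; noncomm_ring
          have c1 : Commute (a k) (b k * b (k + 1)) := (hab _ _).mul_right (hab _ _)
          have c2 : Commute (b (k + 1)) (a k * a (k + 1)) :=
            (hab _ _).symm.mul_right (hab _ _).symm
          have ea : a (k + 1) * ((a k * a (k + 1)) * (b k * b (k + 1))) =
              ((a k * a (k + 1)) * (b k * b (k + 1))) * a k := by
            rw [mul_assoc _ _ (a k), ← c1.eq]
            simp only [← mul_assoc]
            rw [← ha.braid]
          have eb : b (k + 1) * ((a k * a (k + 1)) * (b k * b (k + 1))) =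
              ((a k * a (k + 1)) * (b k * b (k + 1))) * b k := by
            rw [← mul_assoc, c2.eq, mul_assoc, ← mul_assoc (b (k + 1)), ← hb.braid, ← mul_assoc]
          rw [e1, sub_mul, mul_sub, ea, eb]
        have hcomm : Commute (a (k + 1) - b (k + 1)) (cosetSum (fun k => a k * b k) k) :=
          commute_cosetSum fun i hi => hcu (by omega)
        rw [cosetSum, add_mul, one_mul, mul_add]
        have z1 : (a (k + 1) - b (k + 1)) * (cosetSum (fun k => a k * b k) k * (a k * b k) *
            (a (k + 1) * b (k + 1) * C)) = 0 := by
          calc _ = ((a (k + 1) - b (k + 1)) * cosetSum (fun k => a k * b k) k) *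
                (((a k * b k) * (a (k + 1) * b (k + 1))) * C) := by noncomm_ring
            _ = cosetSum (fun k => a k * b k) k * (((a (k + 1) - b (k + 1)) *
                  ((a k * b k) * (a (k + 1) * b (k + 1)))) * C) := by
                rw [hcomm.eq]; simp only [mul_assoc]
            _ = 0 := by
                rw [key, mul_assoc _ _ C, hC k (by omega), mul_zero, mul_zero]
        rw [z1, zero_add]
        calc _ = (a (k + 1) - b (k + 1)) * (a (k + 1) * b (k + 1) + 1) * C := by noncomm_ring
          _ = 0 := by rw [hq, zero_mul]
    · rw [hC i (by omega), add_zero]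
      refine sub_mul_cosetSum_mul ha hb hab hq d _ (fun j hj => ?_) i hi'
      rw [← mul_assoc, (hcu' (by omega)).eq, mul_assoc, hC j (by omega), mul_zero]

theorem sub_mul_symmetrizer (ha : IsBraid a) (hb : IsBraid b)
    (hab : ∀ i j, Commute (a i) (b j))
    (hq : ∀ i, (a i - b i) * (a i * b i + 1) = 0) :
    ∀ (d i : ℕ), i < d → (a i - b i) * symmetrizer (fun k => a k * b k) d = 0
  | 0, _, hi => by omega
  | d + 1, i, hi => by
    rw [symmetrizer]
    exact sub_mul_cosetSum_mul ha hb hab hq (d + 1) _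
      (fun j hj => sub_mul_symmetrizer ha hb hab hq d j (by omega)) i hi

end Symmetrizer

/-! ### The Hecke algebra action on functions of words -/

section Hecke

variable {K : Type*} [CommRing K]

/-- Functions of infinite words in natural numbers. -/
abbrev WordFun (K : Type*) : Type _ := (ℕ → ℕ) → K

/-- The word with the letters at the places `i` and `i + 1` interchanged. -/
def swapAt (i : ℕ) (s : ℕ → ℕ) : ℕ → ℕ := s ∘ Equiv.swap i (i + 1)

/-- The transpose of the braiding in the places `i` and `i + 1`. -/
def hecke (q qi : K) (i : ℕ) : Module.End K (WordFun K) where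
  toFun f s := if s i = s (i + 1) then qi * f s else
    if s i < s (i + 1) then f (swapAt i s) else f (swapAt i s) - (q - qi) * f s
  map_add' f g := by
    ext s; simp only [Pi.add_apply]; split_ifs <;> ring
  map_smul' c f := by
    ext s; simp only [Pi.smul_apply, smul_eq_mul, RingHom.id_apply]; split_ifs <;> ring

theorem hecke_apply (q qi : K) (i : ℕ) (f : WordFun K) (s : ℕ → ℕ) :
    hecke q qi i f s = if s i = s (i + 1) then qi * f s else
      if s i < s (i + 1) then f (swapAt i s) else f (swapAt i s) - (q - qi) * f s := rfl

@[simp] theorem swapAt_left (i : ℕ) (s : ℕ → ℕ) : swapAt i s i = s (i + 1) := by simp [swapAt]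

@[simp] theorem swapAt_right (i : ℕ) (s : ℕ → ℕ) : swapAt i s (i + 1) = s i := by simp [swapAt]

theorem swapAt_of_ne {i j : ℕ} (s : ℕ → ℕ) (h : j ≠ i) (h' : j ≠ i + 1) :
    swapAt i s j = s j := by simp [swapAt, Equiv.swap_apply_of_ne_of_ne h h']

@[simp] theorem swapAt_swapAt (i : ℕ) (s : ℕ → ℕ) : swapAt i (swapAt i s) = s := by
  ext j; simp [swapAt]

theorem swapAt_of_eq {i : ℕ} {s : ℕ → ℕ} (h : s i = s (i + 1)) : swapAt i s = s := by
  ext j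
  by_cases h1 : j = i
  · subst h1; simp [h]
  · by_cases h2 : j = i + 1
    · subst h2; simp [h]
    · exact swapAt_of_ne s h1 h2

theorem swapAt_comm {i j : ℕ} (h : i + 2 ≤ j) (s : ℕ → ℕ) :
    swapAt i (swapAt j s) = swapAt j (swapAt i s) := by
  ext k
  simp only [swapAt, Function.comp, Equiv.swap_apply_def]
  congr 1
  split_ifs <;> omega

theorem swapAt_braid (i : ℕ) (s : ℕ → ℕ) :
    swapAt i (swapAt (i + 1) (swapAt i s)) = swapAt (i + 1) (swapAt i (swapAt (i + 1) s)) := by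
  ext k
  simp only [swapAt, Function.comp, Equiv.swap_apply_def]
  congr 1
  split_ifs <;> omega

theorem hecke_mul_self {q qi : K} (hq : q * qi = 1) (i : ℕ) :
    hecke q qi i * (hecke q qi i + (q - qi) • 1) = 1 := by
  ext f s
  simp only [Module.End.mul_apply, LinearMap.add_apply, LinearMap.smul_apply, Module.End.one_apply,
    hecke_apply, Pi.add_apply, Pi.smul_apply, smul_eq_mul, swapAt_left, swapAt_right,
    swapAt_swapAt]
  rcases lt_trichotomy (s i) (s (i + 1)) with h | h | h
  · simp only [h.ne, h.ne', h, h.not_gt, if_true, if_false]; ring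
  · simp only [h, if_true]; linear_combination f s * hq
  · simp only [h.ne, h.ne', h, h.not_gt, if_true, if_false]; ring

theorem isBraid_hecke {q qi : K} (hq : q * qi = 1) : IsBraid (hecke q qi) where
  braid i := by
    ext f s
    have h1 (s : ℕ → ℕ) : swapAt i s (i + 1 + 1) = s (i + 1 + 1) :=
      swapAt_of_ne s (by omega) (by omega)
    have h2 (s : ℕ → ℕ) : swapAt (i + 1) s i = s i := swapAt_of_ne s (by omega) (by omega)
    simp only [Module.End.mul_apply, hecke_apply, swapAt_left, swapAt_right, h1, h2,
      swapAt_swapAt, swapAt_braid]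
    -- The relation depends only on the relative order of the three letters; of the 27 combinations
    -- the inconsistent ones are discarded by `omega`, and some of the others need `q * qi = 1`.
    rcases lt_trichotomy (s i) (s (i + 1)) with h | h | h <;>
    rcases lt_trichotomy (s i) (s (i + 1 + 1)) with h' | h' | h' <;>
    rcases lt_trichotomy (s (i + 1)) (s (i + 1 + 1)) with h'' | h'' | h'' <;>
    first
    | (exfalso; omega)
    | (simp only [h, h', h'', if_true, if_false, h.ne, h.ne', h'.ne, h'.ne',
        h''.ne, h''.ne', h.not_gt, h'.not_gt, h''.not_gt]; ring)
    | (simp [*, lt_asymm, ne_of_gt, ne_of_lt]; done)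
    | (simp [*, lt_asymm, ne_of_gt, ne_of_lt]; ring1)
    | (simp [*, lt_asymm, ne_of_gt, ne_of_lt]
       linear_combination (-(q - qi) * f s) * hq)
    | (simp [*, lt_asymm, ne_of_gt, ne_of_lt]
       linear_combination ((q - qi) * f s) * hq)
  comm i j hij := by
    ext f s
    have h1 (s : ℕ → ℕ) : swapAt i s j = s j := swapAt_of_ne s (by omega) (by omega)
    have h2 (s : ℕ → ℕ) : swapAt i s (j + 1) = s (j + 1) := swapAt_of_ne s (by omega) (by omega)
    have h3 (s : ℕ → ℕ) : swapAt j s i = s i := swapAt_of_ne s (by omega) (by omega)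
    have h4 (s : ℕ → ℕ) : swapAt j s (i + 1) = s (i + 1) := swapAt_of_ne s (by omega) (by omega)
    simp only [Module.End.mul_apply, hecke_apply, h1, h2, h3, h4, swapAt_comm hij]
    split_ifs <;> ring

end Hecke

/-! ### Symmetrized functions are invariant under the transpose of `Ψ`. -/

section Invariants

variable {K : Type*} [CommRing K]

/-- The inverse of `hecke q qi i`. -/
def heckeInv (q qi : K) (i : ℕ) : Module.End K (WordFun K) :=
  hecke q qi i + (q - qi) • 1

theorem hecke_mul_heckeInv {q qi : K} (hq : q * qi = 1) (i : ℕ) :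
    hecke q qi i * heckeInv q qi i = 1 := hecke_mul_self hq i

theorem heckeInv_mul_hecke {q qi : K} (hq : q * qi = 1) (i : ℕ) :
    heckeInv q qi i * hecke q qi i = 1 := by
  rw [← hecke_mul_heckeInv hq i, heckeInv, add_mul, mul_add, smul_mul_assoc, mul_smul_comm,
    one_mul, mul_one]

/-- The operators `hecke q qi i`, as invertible elements. -/
def heckeUnit {q qi : K} (hq : q * qi = 1) (i : ℕ) : (Module.End K (WordFun K))ˣ where
  val := hecke q qi i
  inv := heckeInv q qi i
  val_inv := hecke_mul_heckeInv hq i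
  inv_val := heckeInv_mul_hecke hq i

/-- The transposed braiding of the first letters of the pairs with the numbers `i`, `i + 1`. -/
def evenHecke (q qi : K) (i : ℕ) : Module.End K (WordFun K) :=
  hecke q qi (2 * i + 1) * hecke q qi (2 * i) * heckeInv q qi (2 * i + 1)

/-- The transposed braiding of the second letters of the pairs with the numbers `i`, `i + 1`. -/
def oddHecke (q qi : K) (i : ℕ) : Module.End K (WordFun K) :=
  hecke q qi (2 * i + 1) * hecke q qi (2 * i + 2) * heckeInv q qi (2 * i + 1)

theorem isBraid_heckeUnit {q qi : K} (hq : q * qi = 1) : IsBraid (heckeUnit hq) where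
  braid i := Units.ext ((isBraid_hecke hq).braid i)
  comm i j hij := Units.ext ((isBraid_hecke hq).comm i j hij)

theorem IsBraid.map {M N : Type*} [Mul M] [Mul N] {s : ℕ → M} (hs : IsBraid s) (f : M →ₙ* N) :
    IsBraid fun i => f (s i) where
  braid i := by simp only [← map_mul, hs.braid]
  comm i j hij := (hs.comm i j hij).map f

theorem isBraid_evenHecke {q qi : K} (hq : q * qi = 1) : IsBraid (evenHecke q qi) :=
  (isBraid_evenTwist (isBraid_heckeUnit hq)).map (Units.coeHom _ : _ →* _).toMulHom

theorem isBraid_oddHecke {q qi : K} (hq : q * qi = 1) : IsBraid (oddHecke q qi) :=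
  (isBraid_oddTwist (isBraid_heckeUnit hq)).map (Units.coeHom _ : _ →* _).toMulHom

theorem commute_evenHecke_oddHecke {q qi : K} (hq : q * qi = 1) (i j : ℕ) :
    Commute (evenHecke q qi i) (oddHecke q qi j) :=
  (commute_evenTwist_oddTwist (isBraid_heckeUnit hq) i j).map (Units.coeHom _)

theorem conj_mul_self {B : Type*} [Ring B] [Algebra K B] {h : K} {g g' t : B} (hg : g * g' = 1)
    (hg' : g' * g = 1) (ht : t * (t + h • 1) = 1) :
    (g * t * g') * (g * t * g') = 1 - h • (g * t * g') := by
  have h1 : t * t = 1 - h • t := by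
    rw [eq_sub_iff_add_eq, ← ht, mul_add, mul_smul_comm, mul_one]
  calc (g * t * g') * (g * t * g') = g * (t * (g' * g) * t) * g' := by noncomm_ring
    _ = 1 - h • (g * t * g') := by
      rw [hg', mul_one, h1, mul_sub, sub_mul, mul_one, hg, mul_smul_comm, smul_mul_assoc]

/-- Both factors satisfy the same quadratic relation, so in `a² b - a b² + a - b` the terms with `h`
cancel and so do the rest. -/
theorem sub_mul_mul_add_one {B : Type*} [Ring B] [Algebra K B] {h : K} {a b : B}
    (hab : Commute a b) (ha : a * a = 1 - h • a) (hb : b * b = 1 - h • b) :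
    (a - b) * (a * b + 1) = 0 := by
  calc (a - b) * (a * b + 1) = (a * a) * b + a - (b * a) * b - b := by noncomm_ring
    _ = (a * a) * b + a - a * (b * b) - b := by rw [← hab.eq, mul_assoc a b b]
    _ = 0 := by
      rw [ha, hb, sub_mul, mul_sub, one_mul, mul_one, smul_mul_assoc, mul_smul_comm]; abel

/-- The transposed braiding of the pairs of letters with the numbers `i`, `i + 1`. -/
def pairHecke (q qi : K) (i : ℕ) : Module.End K (WordFun K) := evenHecke q qi i * oddHecke q qi i

/-- The sum of the lifts of all permutations of the pairs of letters with numbers `0, …, d`. -/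
def pairSymmetrizer (q qi : K) (d : ℕ) : Module.End K (WordFun K) :=
  symmetrizer (pairHecke q qi) d

theorem evenHecke_mul_pairSymmetrizer {q qi : K} (hq : q * qi = 1) {i d : ℕ} (hi : i < d) :
    evenHecke q qi i * pairSymmetrizer q qi d = oddHecke q qi i * pairSymmetrizer q qi d := by
  rw [← sub_eq_zero, ← sub_mul]
  refine sub_mul_symmetrizer (isBraid_evenHecke hq) (isBraid_oddHecke hq)
    (commute_evenHecke_oddHecke hq) (fun i => sub_mul_mul_add_one (h := q - qi)
      (commute_evenHecke_oddHecke hq i i) ?_ ?_) d i hi <;>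
  exact conj_mul_self (hecke_mul_heckeInv hq _) (heckeInv_mul_hecke hq _) (hecke_mul_self hq _)

/-- The transpose of `Ψ`, acting on the places `k`, …, `k + 3`. -/
def heckePsi (q qi : K) (k : ℕ) : Module.End K (WordFun K) :=
  hecke q qi (k + 1) * hecke q qi (k + 2) * hecke q qi k * hecke q qi (k + 1)
    + (q - qi) • (hecke q qi k * hecke q qi (k + 1) * hecke q qi k
      + hecke q qi (k + 1) * hecke q qi (k + 2) * hecke q qi k)
    + (q - qi) ^ 2 • (hecke q qi (k + 1) * hecke q qi k)

/-- Expanding the two inverses as `T + (q - qi)` produces exactly the four terms of `heckePsi`,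
after one braid relation. -/
theorem heckePsi_eq {q qi : K} (hq : q * qi = 1) (k : ℕ) :
    heckePsi q qi k =
      hecke q qi (k + 1) * heckeInv q qi (k + 2) * hecke q qi k * heckeInv q qi (k + 1) := by
  rw [heckePsi, (isBraid_hecke hq).braid k, heckeInv, heckeInv, pow_two, mul_smul]
  simp only [mul_add, add_mul, mul_smul_comm, smul_mul_assoc, mul_one, smul_add]
  abel

/-- By `heckePsi_eq` the operator is the inverse of `oddHecke` times `evenHecke`, and these two
agree on the image of the symmetrizer. -/
theorem heckePsi_mul_pairSymmetrizer {q qi : K} (hq : q * qi = 1) {i d : ℕ} (hi : i < d) :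
    heckePsi q qi (2 * i) * pairSymmetrizer q qi d = pairSymmetrizer q qi d := by
  have hc : heckePsi q qi (2 * i) = hecke q qi (2 * i + 1) * heckeInv q qi (2 * i + 2) *
      heckeInv q qi (2 * i + 1) * evenHecke q qi i := by
    rw [heckePsi_eq hq, evenHecke]
    simp only [mul_assoc]
    rw [← mul_assoc (heckeInv q qi (2 * i + 1)) (hecke q qi (2 * i + 1)),
      heckeInv_mul_hecke hq, one_mul]
  rw [hc, mul_assoc, evenHecke_mul_pairSymmetrizer hq hi, ← mul_assoc]
  have : hecke q qi (2 * i + 1) * heckeInv q qi (2 * i + 2) *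
      heckeInv q qi (2 * i + 1) * oddHecke q qi i = 1 := by
    rw [oddHecke]
    simp only [mul_assoc]
    rw [← mul_assoc (heckeInv q qi (2 * i + 1)) (hecke q qi (2 * i + 1)),
      heckeInv_mul_hecke hq, one_mul, ← mul_assoc (heckeInv q qi (2 * i + 2)),
      heckeInv_mul_hecke hq, one_mul, hecke_mul_heckeInv hq]
  rw [this, one_mul]

/-! #### Change of rings -/

variable {L : Type*} [CommRing L]

/-- Compatibility of operators over two rings with a homomorphism. -/
def Intertwines (φ : K →+* L) (X : Module.End K (WordFun K)) (Y : Module.End L (WordFun L)) :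
    Prop := ∀ f : WordFun K, Y (φ ∘ f) = φ ∘ X f

namespace Intertwines

variable {φ : K →+* L} {X X' : Module.End K (WordFun K)} {Y Y' : Module.End L (WordFun L)}

theorem one : Intertwines φ 1 1 := fun _ => rfl

theorem mul (h : Intertwines φ X Y) (h' : Intertwines φ X' Y') :
    Intertwines φ (X * X') (Y * Y') := fun f => by
  rw [Module.End.mul_apply, h', h, Module.End.mul_apply]

theorem add (h : Intertwines φ X Y) (h' : Intertwines φ X' Y') :
    Intertwines φ (X + X') (Y + Y') := fun f => by
  ext s
  simp [h f, h' f]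

theorem smul (h : Intertwines φ X Y) (c : K) :
    Intertwines φ (c • X) (φ c • Y) := fun f => by
  ext s
  simp [h f]

theorem hecke (q qi : K) (i : ℕ) :
    Intertwines φ (hecke q qi i) (QuantumFolding.hecke (φ q) (φ qi) i) := fun f => by
  ext s
  simp only [hecke_apply, Function.comp_apply]
  split_ifs <;> simp

theorem heckeInv (q qi : K) (i : ℕ) :
    Intertwines φ (heckeInv q qi i) (QuantumFolding.heckeInv (φ q) (φ qi) i) := by
  have := (hecke (φ := φ) q qi i).add (one.smul (q - qi))
  rwa [map_sub] at this

theorem evenHecke (q qi : K) (i : ℕ) :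
    Intertwines φ (evenHecke q qi i) (QuantumFolding.evenHecke (φ q) (φ qi) i) :=
  ((hecke _ _ _).mul (hecke _ _ _)).mul (heckeInv _ _ _)

theorem oddHecke (q qi : K) (i : ℕ) :
    Intertwines φ (oddHecke q qi i) (QuantumFolding.oddHecke (φ q) (φ qi) i) :=
  ((hecke _ _ _).mul (hecke _ _ _)).mul (heckeInv _ _ _)

theorem cosetSum {u : ℕ → Module.End K (WordFun K)} {v : ℕ → Module.End L (WordFun L)}
    (h : ∀ i, Intertwines φ (u i) (v i)) :
    ∀ d, Intertwines φ (cosetSum u d) (QuantumFolding.cosetSum v d)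
  | 0 => one
  | d + 1 => ((cosetSum h d).mul (h d)).add one

theorem symmetrizer {u : ℕ → Module.End K (WordFun K)} {v : ℕ → Module.End L (WordFun L)}
    (h : ∀ i, Intertwines φ (u i) (v i)) :
    ∀ d, Intertwines φ (symmetrizer u d) (QuantumFolding.symmetrizer v d)
  | 0 => one
  | d + 1 => (cosetSum h (d + 1)).mul (symmetrizer h d)

theorem pairSymmetrizer (q qi : K) (d : ℕ) :
    Intertwines φ (pairSymmetrizer q qi d) (QuantumFolding.pairSymmetrizer (φ q) (φ qi) d) :=
  symmetrizer (fun i => (evenHecke q qi i).mul (oddHecke q qi i)) d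

end Intertwines

end Invariants

/-! ### Words in pairs of letters -/

section Words

/-- A finite word, continued by zeros. -/
def padded (l : List ℕ) : ℕ → ℕ := fun k => l.getD k 0

theorem padded_at (u : List ℕ) (a : ℕ) (v : List ℕ) : padded (u ++ a :: v) u.length = a := by
  simp [padded]

theorem padded_at_succ (u : List ℕ) (a b : ℕ) (v : List ℕ) :
    padded (u ++ a :: b :: v) (u.length + 1) = b := by
  simp [padded]

theorem swapAt_padded (u : List ℕ) (a b : ℕ) (v : List ℕ) :
    swapAt u.length (padded (u ++ a :: b :: v)) = padded (u ++ b :: a :: v) := by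
  ext k
  by_cases h1 : k = u.length
  · subst h1; rw [swapAt_left, padded_at, padded_at_succ]
  · by_cases h2 : k = u.length + 1
    · subst h2; rw [swapAt_right, padded_at, padded_at_succ]
    · rw [swapAt_of_ne _ h1 h2]
      obtain h | ⟨j, rfl⟩ : k < u.length ∨ ∃ j, k = u.length + (j + 2) := by
        rcases lt_or_ge k u.length with h | h
        · exact .inl h
        · exact .inr ⟨k - u.length - 2, by omega⟩
      · simp [padded, List.getElem?_append_left h]
      · simp [padded, List.getElem?_append_right]

/-- The word in natural numbers that lists the entries of a word in pairs. -/
def flat {n : ℕ} (w : List (Fin n × Fin n)) : List ℕ := w.flatMap fun p => [(p.1 : ℕ), (p.2 : ℕ)]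

variable {n : ℕ}

@[simp] theorem length_flat (w : List (Fin n × Fin n)) : (flat w).length = 2 * w.length := by
  induction w with
  | nil => rfl
  | cons p w ih => simp [flat] at ih ⊢; omega

theorem flat_append (w w' : List (Fin n × Fin n)) : flat (w ++ w') = flat w ++ flat w' := by
  simp [flat]

theorem flat_cons (p : Fin n × Fin n) (w : List (Fin n × Fin n)) :
    flat (p :: w) = (p.1 : ℕ) :: (p.2 : ℕ) :: flat w := by
  simp [flat]

theorem flat_injective : Function.Injective (flat (n := n)) := by
  intro w
  induction w with
  | nil => intro w' h; cases w' <;> simp_all [flat]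
  | cons p w ih =>
    intro w' h
    cases w' with
    | nil => simp [flat] at h
    | cons p' w' =>
      simp only [flat_cons, List.cons.injEq] at h
      rw [ih h.2.2, Prod.ext (Fin.ext h.1) (Fin.ext h.2.1)]

theorem padded_injective {l l' : List ℕ} (hl : l.length = l'.length) (h : padded l = padded l') :
    l = l' := by
  refine List.ext_getElem hl fun k h1 h2 => ?_
  have := congrFun h k
  simpa [padded, h1, h2] using this

/-- The infinite word of a word in pairs. -/
def wordSeq (w : List (Fin n × Fin n)) : ℕ → ℕ := padded (flat w)

theorem wordSeq_injective {w w' : List (Fin n × Fin n)} (hl : w.length = w'.length)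
    (h : wordSeq w = wordSeq w') : w = w' :=
  flat_injective (padded_injective (by simp [hl]) h)

end Words

/-! ### Invariant functions of words in pairs -/

section WordForm

variable {K L : Type*} [CommRing K] [CommRing L] {n : ℕ}

/-- The indicator function of a word. -/
def indicator (K : Type*) [CommRing K] (s₀ : ℕ → ℕ) : WordFun K :=
  open Classical in fun s => if s = s₀ then 1 else 0

/-- The symmetrization of the coordinate function of the word `b`, evaluated at the word `w`. -/
def wordForm (q qi : K) (b w : List (Fin n × Fin n)) : K :=
  -- Padding by zeros cannot tell the letter `0` from the end of a word, hence the test of lengths.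
  -- A word of `d + 1` pairs has `d` neighbouring transpositions; for the empty word the truncated
  -- difference gives the symmetrizer `1`.
  if w.length = b.length then
    pairSymmetrizer q qi (b.length - 1) (indicator K (wordSeq b)) (wordSeq w) else 0

/-- The construction uses only ring operations in `q` and `qi`. This is what connects the values in
`ℂ(q)`, in the local ring and at `q = 1`, and reduces positivity to the integers. -/
theorem map_wordForm (φ : K →+* L) (q qi : K) (b w : List (Fin n × Fin n)) :
    φ (wordForm q qi b w) = wordForm (φ q) (φ qi) b w := by
  unfold wordForm
  split_ifs
  · have h1 : indicator L (wordSeq b) = φ ∘ indicator K (wordSeq b) := by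
      ext s; simp only [indicator, Function.comp_apply]; split_ifs <;> simp
    rw [h1, Intertwines.pairSymmetrizer q qi]; rfl
  · simp

/-! #### The case `q = 1` -/

/-- The infinite word with two consecutive pairs interchanged. -/
def pairSwap (i : ℕ) (s : ℕ → ℕ) : ℕ → ℕ :=
  swapAt (2 * i + 1) (swapAt (2 * i + 2) (swapAt (2 * i) (swapAt (2 * i + 1) s)))

theorem hecke_one_apply (i : ℕ) (f : WordFun K) (s : ℕ → ℕ) :
    hecke 1 1 i f s = f (swapAt i s) := by
  rw [hecke_apply]
  split_ifs with h h'
  · rw [swapAt_of_eq h, one_mul]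
  · rfl
  · simp

theorem heckeInv_one (i : ℕ) : heckeInv (1 : K) 1 i = hecke 1 1 i := by
  simp [heckeInv]

theorem pairHecke_one_apply (i : ℕ) (f : WordFun K) (s : ℕ → ℕ) :
    pairHecke (1 : K) 1 i f s = f (pairSwap i s) := by
  simp only [pairHecke, evenHecke, oddHecke, heckeInv_one, Module.End.mul_apply, hecke_one_apply,
    swapAt_swapAt, pairSwap]

theorem pairSwap_wordSeq (u : List (Fin n × Fin n)) (p r : Fin n × Fin n)
    (v : List (Fin n × Fin n)) :
    pairSwap u.length (wordSeq (u ++ p :: r :: v)) = wordSeq (u ++ r :: p :: v) := by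
  have h0 : 2 * u.length = (flat u).length := (length_flat u).symm
  have h1 (a : ℕ) : 2 * u.length + 1 = (flat u ++ [a]).length := by simp
  have h2 (a b : ℕ) : 2 * u.length + 2 = (flat u ++ [a, b]).length := by simp
  simp only [wordSeq, flat_append, flat_cons, pairSwap]
  have e1 (a : ℕ) (l : List ℕ) : flat u ++ a :: l = (flat u ++ [a]) ++ l := by simp
  have e2 (a b : ℕ) (l : List ℕ) : flat u ++ a :: b :: l = (flat u ++ [a, b]) ++ l := by simp
  rw [e1, h1 p.1, swapAt_padded, ← e1, ← h1 p.1, h0, swapAt_padded, ← h0, e2, h2 r.1 p.1,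
    swapAt_padded, ← e2, e1, h1 r.1, swapAt_padded, ← e1]

theorem exists_eq_append_cons_cons {α : Type*} {w : List α} {i : ℕ} (h : i + 1 < w.length) :
    ∃ u p r v, w = u ++ p :: r :: v ∧ u.length = i :=
  ⟨w.take i, w[i], w[i + 1], w.drop (i + 2), by simp, by simp; omega⟩

theorem cosetSum_eq_zero_of_forall {S : Set (ℕ → ℕ)} :
    ∀ {d : ℕ} {f : WordFun K}, (∀ i < d, ∀ s ∈ S, pairSwap i s ∈ S) → (∀ s ∈ S, f s = 0) →
      ∀ s ∈ S, cosetSum (pairHecke (1 : K) 1) d f s = 0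
  | 0, _, _, hf, s, hs => hf s hs
  | d + 1, f, hS, hf, s, hs => by
    rw [cosetSum, LinearMap.add_apply, Module.End.mul_apply, Module.End.one_apply, Pi.add_apply,
      hf s hs, add_zero]
    refine cosetSum_eq_zero_of_forall (fun i hi => hS i (by omega)) (fun s hs => ?_) s hs
    rw [pairHecke_one_apply]
    exact hf _ (hS d (by omega) s hs)

theorem pairSymmetrizer_eq_zero_of_forall {S : Set (ℕ → ℕ)} :
    ∀ {d : ℕ} {f : WordFun K}, (∀ i < d, ∀ s ∈ S, pairSwap i s ∈ S) → (∀ s ∈ S, f s = 0) →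
      ∀ s ∈ S, pairSymmetrizer (1 : K) 1 d f s = 0
  | 0, _, _, hf, s, hs => hf s hs
  | d + 1, _, hS, hf, s, hs => cosetSum_eq_zero_of_forall hS
      (pairSymmetrizer_eq_zero_of_forall (fun i hi => hS i (by omega)) hf) s hs

theorem le_cosetSum : ∀ (d : ℕ) {f : WordFun ℤ}, 0 ≤ f →
    f ≤ cosetSum (pairHecke (1 : ℤ) 1) d f
  | 0, _, _ => le_rfl
  | d + 1, f, hf => by
    have h0 : 0 ≤ pairHecke (1 : ℤ) 1 d f := fun s => by
      rw [pairHecke_one_apply]; exact hf _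
    have h1 := h0.trans (le_cosetSum d h0)
    rw [cosetSum, LinearMap.add_apply, Module.End.mul_apply, Module.End.one_apply]
    exact le_add_of_nonneg_left h1

theorem le_pairSymmetrizer : ∀ (d : ℕ) {f : WordFun ℤ}, 0 ≤ f →
    f ≤ pairSymmetrizer (1 : ℤ) 1 d f
  | 0, _, _ => le_rfl
  | d + 1, _, hf =>
    have h := le_pairSymmetrizer d hf
    h.trans (le_cosetSum (d + 1) (hf.trans h))

/-- At `q = 1` the symmetrizer only moves pairs around, so it preserves vanishing on the words that
are not rearrangements of `b`. -/
theorem wordForm_one_eq_zero {b w : List (Fin n × Fin n)} (h : ¬ w.Perm b) :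
    wordForm (1 : K) 1 b w = 0 := by
  unfold wordForm
  split_ifs with hl
  · refine pairSymmetrizer_eq_zero_of_forall
      (S := {s | ∃ w : List (Fin n × Fin n), s = wordSeq w ∧ w.length = b.length ∧ ¬ w.Perm b})
      ?_ ?_ _ ⟨w, rfl, hl, h⟩
    · rintro i hi _ ⟨w, rfl, hl, h⟩
      obtain ⟨u, p, r, v, rfl, rfl⟩ := exists_eq_append_cons_cons (w := w) (i := i) (by omega)
      refine ⟨_, pairSwap_wordSeq u p r v, by simpa using hl, fun h' => h (.trans ?_ h')⟩
      exact (List.Perm.swap _ _ _).append_left _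
    · rintro _ ⟨w, rfl, hl, h⟩
      refine if_neg fun h' => h ?_
      rw [wordSeq_injective hl h']
  · rfl

/-- Over `ℤ` the symmetrizer at `q = 1` is a sum of permutations including the identity, so it
cannot decrease a nonnegative function: the value is at least `1`. -/
theorem wordForm_one_self_ne_zero [CharZero K] (b : List (Fin n × Fin n)) :
    wordForm (1 : K) 1 b b ≠ 0 := by
  have h : wordForm (1 : ℤ) 1 b b ≠ 0 := by
    rw [wordForm, if_pos rfl]
    have h0 : 0 ≤ indicator ℤ (wordSeq b) := fun s => by
      simp only [indicator]; split_ifs <;> simp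
    have h1 := le_pairSymmetrizer (b.length - 1) h0 (wordSeq b)
    have h2 : indicator ℤ (wordSeq b) (wordSeq b) = 1 := if_pos rfl
    rw [h2] at h1
    exact (zero_lt_one.trans_le h1).ne'
  have h1 := map_wordForm (Int.castRingHom K) 1 1 b b
  rw [map_one] at h1
  rw [← h1]
  simpa using h

/-- At `q = 1` the even twist is an involution. On symmetrized functions the odd twist equals the
even one, so their product, which interchanges the two pairs, acts trivially. -/
theorem wordForm_one_swap (b u : List (Fin n × Fin n)) (p r : Fin n × Fin n)
    (v : List (Fin n × Fin n)) :
    wordForm (1 : K) 1 b (u ++ p :: r :: v) = wordForm (1 : K) 1 b (u ++ r :: p :: v) := by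
  unfold wordForm
  have hl : (u ++ p :: r :: v).length = (u ++ r :: p :: v).length := by simp
  rw [hl]
  split_ifs with h
  · have hi : u.length < b.length - 1 := by simp at h; omega
    have h1 : evenHecke (1 : K) 1 u.length * evenHecke 1 1 u.length = 1 := by
      have := conj_mul_self (h := (1 - 1 : K)) (hecke_mul_heckeInv (mul_one 1) (2 * u.length + 1))
        (heckeInv_mul_hecke (mul_one 1) _) (hecke_mul_self (mul_one 1) (2 * u.length))
      rwa [sub_self, zero_smul, sub_zero] at this
    have h2 : pairHecke (1 : K) 1 u.length *
        pairSymmetrizer 1 1 (b.length - 1) = pairSymmetrizer 1 1 (b.length - 1) := by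
      rw [pairHecke, mul_assoc, ← evenHecke_mul_pairSymmetrizer (mul_one 1) hi, ← mul_assoc, h1, one_mul]
    have h3 := LinearMap.congr_fun h2 (indicator K (wordSeq b))
    rw [Module.End.mul_apply] at h3
    generalize pairSymmetrizer (1 : K) 1 (b.length - 1) (indicator K (wordSeq b)) = f at h3
    have h4 := pairHecke_one_apply u.length f (wordSeq (u ++ p :: r :: v))
    rw [h3, pairSwap_wordSeq] at h4
    exact h4
  · rfl

theorem wordForm_one_perm (b : List (Fin n × Fin n)) {w w' : List (Fin n × Fin n)}
    (h : w.Perm w') : wordForm (1 : K) 1 b w = wordForm (1 : K) 1 b w' := by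
  suffices ∀ u, wordForm (1 : K) 1 b (u ++ w) = wordForm (1 : K) 1 b (u ++ w') from this []
  induction h with
  | nil => exact fun _ => rfl
  | cons p _ ih => intro u; rw [List.append_cons, ih, ← List.append_cons]
  | swap p r v => exact fun u => wordForm_one_swap b u r p v
  | trans _ _ ih ih' => exact fun u => (ih u).trans (ih' u)

end WordForm

/-! ### The functionals on `S_q(V ⊗ V)` -/

section Functional

variable {n : ℕ}

/-- The functional on `V^{⊗4}` obtained from a function of words, by filling in the letters of a
basis vector between `u` and `v`. -/
def fillIn (n : ℕ) (u v : List ℕ) (f : WordFun Cq) : V4 n →ₗ[Cq] Cq :=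
  ((basisVV n).tensorProduct (basisVV n)).constr Cq fun p =>
    f (padded (u ++ (p.1.1 : ℕ) :: (p.1.2 : ℕ) :: (p.2.1 : ℕ) :: (p.2.2 : ℕ) :: v))

theorem basisVV_apply (p : Fin n × Fin n) :
    basisVV n p = Pi.basisFun Cq (Fin n) p.1 ⊗ₜ Pi.basisFun Cq (Fin n) p.2 := by
  rw [basisVV, Module.Basis.tensorProduct_apply']

theorem fillIn_tmul (u v : List ℕ) (f : WordFun Cq) (p r : Fin n × Fin n) :
    fillIn n u v f (basisVV n p ⊗ₜ basisVV n r) =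
      f (padded (u ++ (p.1 : ℕ) :: (p.2 : ℕ) :: (r.1 : ℕ) :: (r.2 : ℕ) :: v)) := by
  rw [fillIn, ← Module.Basis.tensorProduct_apply, Module.Basis.constr_basis]

theorem sub_smul_eq_add_smul {K M : Type*} [Ring K] [AddCommGroup M] [Module K M] (a b : M)
    (r s : K) : a - (r - s) • b = a + (s - r) • b := by
  rw [← neg_sub r s, neg_smul, sub_eq_add_neg]

theorem T_basisVV (p : Fin n × Fin n) : T n (basisVV n p) =
    if p.1 = p.2 then q⁻¹ • basisVV n p
    else if p.1 < p.2 then basisVV n (p.2, p.1)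
    else basisVV n (p.2, p.1) + (q⁻¹ - q) • basisVV n p := by
  rw [T, Module.Basis.constr_basis]
  split_ifs
  · rfl
  · rfl
  · exact sub_smul_eq_add_smul _ _ _ _

theorem hecke_padded (f : WordFun Cq) (u : List ℕ) (a b : Fin n) (v : List ℕ) :
    hecke q q⁻¹ u.length f (padded (u ++ (a : ℕ) :: (b : ℕ) :: v)) =
      if a = b then q⁻¹ * f (padded (u ++ (a : ℕ) :: (b : ℕ) :: v))
      else if a < b then f (padded (u ++ (b : ℕ) :: (a : ℕ) :: v))
      else f (padded (u ++ (b : ℕ) :: (a : ℕ) :: v)) +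
        (q⁻¹ - q) * f (padded (u ++ (a : ℕ) :: (b : ℕ) :: v)) := by
  rw [hecke_apply, padded_at, padded_at_succ, swapAt_padded]
  simp only [Fin.val_inj, Fin.val_fin_lt]
  split_ifs
  · rfl
  · rfl
  · ring

theorem fillIn_Psi1 (u v : List ℕ) (f : WordFun Cq) (y : V4 n) :
    fillIn n u v f (Psi1 n y) = fillIn n u v (hecke q q⁻¹ u.length f) y := by
  suffices fillIn n u v f ∘ₗ Psi1 n = fillIn n u v (hecke q q⁻¹ u.length f) from
    LinearMap.congr_fun this y
  refine ((basisVV n).tensorProduct (basisVV n)).ext fun ⟨p, r⟩ => ?_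
  rw [Module.Basis.tensorProduct_apply, LinearMap.comp_apply, Psi1, TensorProduct.map_tmul,
    LinearMap.id_apply, T_basisVV, fillIn_tmul, hecke_padded]
  split_ifs
  · rw [← TensorProduct.smul_tmul', map_smul, fillIn_tmul, smul_eq_mul]
  · rw [fillIn_tmul]
  · rw [TensorProduct.add_tmul, ← TensorProduct.smul_tmul', map_add, map_smul, fillIn_tmul,
      fillIn_tmul, smul_eq_mul]

theorem fillIn_Psi3 (u v : List ℕ) (f : WordFun Cq) (y : V4 n) :
    fillIn n u v f (Psi3 n y) = fillIn n u v (hecke q q⁻¹ (u.length + 2) f) y := by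
  suffices fillIn n u v f ∘ₗ Psi3 n = fillIn n u v (hecke q q⁻¹ (u.length + 2) f) from
    LinearMap.congr_fun this y
  refine ((basisVV n).tensorProduct (basisVV n)).ext fun ⟨p, r⟩ => ?_
  have e (x y : ℕ) : u ++ (p.1 : ℕ) :: (p.2 : ℕ) :: x :: y :: v =
      (u ++ [(p.1 : ℕ), (p.2 : ℕ)]) ++ x :: y :: v := by simp
  have hl : u.length + 2 = (u ++ [(p.1 : ℕ), (p.2 : ℕ)]).length := by simp
  rw [Module.Basis.tensorProduct_apply, LinearMap.comp_apply, Psi3, TensorProduct.map_tmul,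
    LinearMap.id_apply, T_basisVV, fillIn_tmul, e, hl, hecke_padded]
  split_ifs
  · rw [TensorProduct.tmul_smul, map_smul, fillIn_tmul, smul_eq_mul, e]
  · rw [fillIn_tmul, e]
  · rw [TensorProduct.tmul_add, TensorProduct.tmul_smul, map_add, map_smul, fillIn_tmul,
      fillIn_tmul, smul_eq_mul, e, e]

theorem Psi2_basis (i j k l : Fin n) : Psi2 n (basisVV n (i, j) ⊗ₜ basisVV n (k, l)) =
    if j = k then q⁻¹ • (basisVV n (i, j) ⊗ₜ basisVV n (k, l))
    else if j < k then basisVV n (i, k) ⊗ₜ basisVV n (j, l)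
    else basisVV n (i, k) ⊗ₜ basisVV n (j, l) +
      (q⁻¹ - q) • (basisVV n (i, j) ⊗ₜ basisVV n (k, l)) := by
  have h1 (i j k l : Fin n) : middle n (basisVV n (i, j) ⊗ₜ basisVV n (k, l)) =
      Pi.basisFun Cq (Fin n) i ⊗ₜ (basisVV n (j, k) ⊗ₜ Pi.basisFun Cq (Fin n) l) := by
    simp [middle, basisVV_apply]
  have h2 (i j k l : Fin n) : (middle n).symm (Pi.basisFun Cq (Fin n) i ⊗ₜ
      (basisVV n (j, k) ⊗ₜ Pi.basisFun Cq (Fin n) l)) =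
        basisVV n (i, j) ⊗ₜ basisVV n (k, l) := by
    rw [LinearEquiv.symm_apply_eq, h1]
  simp only [Psi2, LinearMap.comp_apply, LinearEquiv.coe_coe]
  rw [h1, TensorProduct.map_tmul, TensorProduct.map_tmul, T_basisVV]
  simp only [LinearMap.id_apply]
  split_ifs
  · rw [← TensorProduct.smul_tmul', TensorProduct.tmul_smul, map_smul, h2]
  · rw [h2]
  · rw [TensorProduct.add_tmul, TensorProduct.tmul_add, ← TensorProduct.smul_tmul',
      TensorProduct.tmul_smul, map_add, map_smul, h2, h2]

theorem fillIn_Psi2 (u v : List ℕ) (f : WordFun Cq) (y : V4 n) :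
    fillIn n u v f (Psi2 n y) = fillIn n u v (hecke q q⁻¹ (u.length + 1) f) y := by
  suffices fillIn n u v f ∘ₗ Psi2 n = fillIn n u v (hecke q q⁻¹ (u.length + 1) f) from
    LinearMap.congr_fun this y
  refine ((basisVV n).tensorProduct (basisVV n)).ext fun ⟨⟨i, j⟩, ⟨k, l⟩⟩ => ?_
  have e (x y z : ℕ) : u ++ (i : ℕ) :: x :: y :: z :: v =
      (u ++ [(i : ℕ)]) ++ x :: y :: z :: v := by simp
  have hl : u.length + 1 = (u ++ [(i : ℕ)]).length := by simp
  rw [Module.Basis.tensorProduct_apply, LinearMap.comp_apply, Psi2_basis, fillIn_tmul, e, hl,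
    hecke_padded]
  split_ifs
  · rw [map_smul, fillIn_tmul, smul_eq_mul, e]
  · rw [fillIn_tmul, e]
  · rw [map_add, map_smul, fillIn_tmul, fillIn_tmul, smul_eq_mul, e, e]

/-- Transposition reverses products, which explains the order of the factors in `heckePsi`. -/
theorem fillIn_Psi (u v : List ℕ) (f : WordFun Cq) (y : V4 n) :
    fillIn n u v f (Psi n y) = fillIn n u v (heckePsi q q⁻¹ u.length f) y := by
  have hadd (f g : WordFun Cq) : fillIn n u v (f + g) = fillIn n u v f + fillIn n u v g := by
    refine ((basisVV n).tensorProduct (basisVV n)).ext fun ⟨p, r⟩ => ?_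
    simp [fillIn_tmul]
  have hsmul (c : Cq) (f : WordFun Cq) : fillIn n u v (c • f) = c • fillIn n u v f := by
    refine ((basisVV n).tensorProduct (basisVV n)).ext fun ⟨p, r⟩ => ?_
    simp [fillIn_tmul]
  simp only [Psi, heckePsi, LinearMap.add_apply, LinearMap.smul_apply, Module.End.mul_apply,
    map_add, map_smul, hadd, hsmul, fillIn_Psi1, fillIn_Psi2, fillIn_Psi3]

end Functional

theorem basisFreeMonoid_apply (R : Type*) {κ : Type*} [CommRing R] (w : FreeMonoid κ) :
    FreeAlgebra.basisFreeMonoid R κ w = (w.toList.map (FreeAlgebra.ι R)).prod := by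
  rw [FreeAlgebra.basisFreeMonoid, Module.Basis.map_apply, Finsupp.coe_basisSingleOne]
  change MonoidAlgebra.lift R _ _ (FreeMonoid.lift (FreeAlgebra.ι R)) (MonoidAlgebra.single w 1) = _
  rw [MonoidAlgebra.lift_single, one_smul, FreeMonoid.lift_apply]

section Functional

variable {n : ℕ}

/-- The product of a word in the tensor algebra. -/
def tensorWord (w : List (Fin n × Fin n)) : TensorAlgebra Cq (V n ⊗[Cq] V n) :=
  (w.map fun p => TensorAlgebra.ι Cq (basisVV n p)).prod

theorem tensorAlgebra_basis_apply (w : FreeMonoid (Fin n × Fin n)) :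
    (basisVV n).tensorAlgebra w = tensorWord w.toList := by
  rw [Module.Basis.tensorAlgebra, Module.Basis.map_apply, basisFreeMonoid_apply]
  change (TensorAlgebra.equivFreeAlgebra (basisVV n)).symm _ = _
  rw [map_list_prod, List.map_map, tensorWord]
  congr 2
  ext p
  exact TensorAlgebra.equivFreeAlgebra_symm_ι _ p

/-- The functional on the tensor algebra with the values `wordForm q q⁻¹ b w` at the words `w`. -/
def tensorForm (b : List (Fin n × Fin n)) : TensorAlgebra Cq (V n ⊗[Cq] V n) →ₗ[Cq] Cq :=
  (basisVV n).tensorAlgebra.constr Cq fun w => wordForm q q⁻¹ b w.toList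

theorem tensorForm_tensorWord (b w : List (Fin n × Fin n)) :
    tensorForm b (tensorWord w) = wordForm q q⁻¹ b w := by
  rw [← FreeMonoid.toList_ofList w, ← tensorAlgebra_basis_apply, tensorForm,
    Module.Basis.constr_basis]

theorem q_ne_zero : q ≠ 0 := RatFunc.X_ne_zero

theorem tensorForm_word_Psi (b u v : List (Fin n × Fin n)) (y : V4 n) :
    tensorForm b (tensorWord u * degTwo n (Psi n y) * tensorWord v) =
      tensorForm b (tensorWord u * degTwo n y * tensorWord v) := by
  -- With words placed on both sides, `tensorForm b` restricted to the middle degree two part is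
  -- `fillIn` of the symmetrized function, or zero if the total length is wrong.
  have key : tensorForm b ∘ₗ LinearMap.mulRight Cq (tensorWord v) ∘ₗ
      LinearMap.mulLeft Cq (tensorWord u) ∘ₗ degTwo n =
        if u.length + (v.length + 2) = b.length then fillIn n (flat u) (flat v)
          (pairSymmetrizer q q⁻¹ (b.length - 1) (indicator Cq (wordSeq b))) else 0 := by
    refine ((basisVV n).tensorProduct (basisVV n)).ext fun ⟨p, r⟩ => ?_
    rw [Module.Basis.tensorProduct_apply]
    have h1 : tensorWord u * degTwo n (basisVV n p ⊗ₜ basisVV n r) * tensorWord v =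
        tensorWord (u ++ p :: r :: v) := by
      simp [degTwo, tensorWord, mul_assoc]
    simp only [LinearMap.comp_apply, LinearMap.mulLeft_apply, LinearMap.mulRight_apply]
    rw [h1, tensorForm_tensorWord, wordForm]
    simp only [List.length_append, List.length_cons, add_assoc, Nat.reduceAdd]
    split_ifs
    · rw [fillIn_tmul, wordSeq, wordSeq, flat_append, flat_cons, flat_cons]
    · simp
  have h2 (y : V4 n) := LinearMap.congr_fun key y
  simp only [LinearMap.comp_apply, LinearMap.mulLeft_apply, LinearMap.mulRight_apply] at h2
  rw [h2, h2]
  split_ifs with h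
  · rw [fillIn_Psi, length_flat, ← Module.End.mul_apply, heckePsi_mul_pairSymmetrizer
      (mul_inv_cancel₀ q_ne_zero) (by omega)]
  · rfl

theorem tensorForm_mul_Psi_mul (b : List (Fin n × Fin n)) (y : V4 n)
    (c d : TensorAlgebra Cq (V n ⊗[Cq] V n)) :
    tensorForm b (c * degTwo n (Psi n y) * d) = tensorForm b (c * degTwo n y * d) := by
  have h1 (u : List (Fin n × Fin n)) :
      tensorForm b (tensorWord u * degTwo n (Psi n y) * d) =
        tensorForm b (tensorWord u * degTwo n y * d) := by
    have : tensorForm b ∘ₗ LinearMap.mulLeft Cq (tensorWord u * degTwo n (Psi n y)) =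
        tensorForm b ∘ₗ LinearMap.mulLeft Cq (tensorWord u * degTwo n y) := by
      refine (basisVV n).tensorAlgebra.ext fun v => ?_
      simp only [LinearMap.comp_apply, LinearMap.mulLeft_apply, tensorAlgebra_basis_apply]
      exact tensorForm_word_Psi b u _ y
    exact LinearMap.congr_fun this d
  have : tensorForm b ∘ₗ LinearMap.mulRight Cq (degTwo n (Psi n y) * d) =
      tensorForm b ∘ₗ LinearMap.mulRight Cq (degTwo n y * d) := by
    refine (basisVV n).tensorAlgebra.ext fun u => ?_
    simp only [LinearMap.comp_apply, LinearMap.mulRight_apply, tensorAlgebra_basis_apply,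
      ← mul_assoc]
    exact h1 _
  simpa only [LinearMap.comp_apply, LinearMap.mulRight_apply, ← mul_assoc] using
    LinearMap.congr_fun this c

/-- Equality in `RingQuot` is the equivalence generated by `RingQuot.Rel`. Invariance under
arbitrary factors `c` and `d` on the two sides is the strengthening that survives the closure under
products. -/
theorem tensorForm_eq_of_mkAlgHom_eq (b : List (Fin n × Fin n))
    {a a' : TensorAlgebra Cq (V n ⊗[Cq] V n)}
    (h : RingQuot.mkAlgHom Cq (SqRel n) a = RingQuot.mkAlgHom Cq (SqRel n) a') :
    tensorForm b a = tensorForm b a' := by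
  have h' : (⟨Quot.mk _ a⟩ : RingQuot (SqRel n)) = ⟨Quot.mk _ a'⟩ := by
    simpa [RingQuot.mkAlgHom_def, RingQuot.mkRingHom_def] using h
  have key : ∀ {a a'}, RingQuot.Rel (SqRel n) a a' → ∀ c d,
      tensorForm b (c * a * d) = tensorForm b (c * a' * d) := by
    intro a a' h
    induction h with
    | of h => cases h with | mk y => exact tensorForm_mul_Psi_mul b y
    | add_left _ ih => intro c d; simp only [mul_add, add_mul, map_add, ih]
    | mul_left _ ih => intro c d; simpa only [mul_assoc] using ih c (_ * d)
    | mul_right _ ih => intro c d; simpa only [mul_assoc] using ih (c * _) d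
  have h2 := Quot.eqvGen_exact (RingQuot.mk.inj h')
  clear h h'
  induction h2 with
  | rel _ _ h => simpa using key h 1 1
  | refl => rfl
  | symm _ _ _ ih => exact ih.symm
  | trans _ _ _ _ _ ih ih' => exact ih.trans ih'

theorem mkAlgHom_tensorWord (w : List (Fin n × Fin n)) :
    RingQuot.mkAlgHom Cq (SqRel n) (tensorWord w) = (w.map (x n)).prod := by
  rw [tensorWord, map_list_prod, List.map_map]; rfl

theorem exists_functional (b : List (Fin n × Fin n)) :
    ∃ Λ : Sq n →ₗ[Cq] Cq, ∀ w, Λ (w.map (x n)).prod = wordForm q q⁻¹ b w := by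
  let g : TensorAlgebra Cq (V n ⊗[Cq] V n) →ₗ[Cq] Sq n :=
    (RingQuot.mkAlgHom Cq (SqRel n)).toLinearMap
  have hg : Function.Surjective g := RingQuot.mkAlgHom_surjective Cq (SqRel n)
  have hker : LinearMap.ker g ≤ LinearMap.ker (tensorForm b) := fun a ha => by
    rw [LinearMap.mem_ker] at ha ⊢
    rw [tensorForm_eq_of_mkAlgHom_eq b (a' := 0) (by rw [map_zero]; exact ha), map_zero]
  refine ⟨(LinearMap.ker g).liftQ (tensorForm b) hker ∘ₗ
    (g.quotKerEquivOfSurjective hg).symm.toLinearMap, fun w => ?_⟩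
  rw [← mkAlgHom_tensorWord, ← tensorForm_tensorWord]
  have : (g.quotKerEquivOfSurjective hg).symm (g (tensorWord w)) =
      Submodule.Quotient.mk (tensorWord w) := by
    rw [LinearEquiv.symm_apply_eq]; rfl
  rw [LinearMap.comp_apply]
  exact (congrArg _ this).trans rfl

end Functional

/-! ### The local ring at `q = 1` -/

section LocalRing

open Polynomial

theorem mem_regularAtOne_of_eq_div {f : Cq} {a b : ℂ[X]} (hb : b.eval 1 ≠ 0)
    (h : f = algebraMap ℂ[X] Cq a / algebraMap ℂ[X] Cq b) : f ∈ regularAtOne := by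
  have hb0 : b ≠ 0 := by rintro rfl; simp at hb
  have hd : f.denom ∣ b := (RatFunc.denom_dvd hb0).2 ⟨a, h⟩
  exact fun h' => hb (eval_eq_zero_of_dvd_of_eval_eq_zero hd h')

/-- Evaluation at `q = 1`, as a homomorphism. -/
def evalOne : regularAtOne →+* ℂ where
  toFun f := valueAtOne f
  map_one' := by simp [valueAtOne]
  map_zero' := by simp [valueAtOne]
  map_mul' f g := RatFunc.eval_mul _ _ (by rw [eval₂_id]; exact f.2) (by rw [eval₂_id]; exact g.2)
  map_add' f g := RatFunc.eval_add _ _ (by rw [eval₂_id]; exact f.2) (by rw [eval₂_id]; exact g.2)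

/-- The constants in the local ring. -/
def constant : ℂ →+* regularAtOne :=
  (algebraMap ℂ Cq).codRestrict regularAtOne fun c =>
    mem_regularAtOne_of_eq_div (a := C c) (b := 1) (by simp)
      (by rw [map_one, div_one]; rfl)

theorem evalOne_constant (c : ℂ) : evalOne (constant c) = c := by
  change RatFunc.eval _ _ (RatFunc.C c) = c
  simp

/-- The element `q` of the local ring. -/
def qLocal : regularAtOne :=
  ⟨q, mem_regularAtOne_of_eq_div (a := Polynomial.X) (b := 1) (by simp) (by simp [q])⟩

/-- The element `q⁻¹` of the local ring. -/
def qInvLocal : regularAtOne :=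
  ⟨q⁻¹, mem_regularAtOne_of_eq_div (a := 1) (b := Polynomial.X) (by simp) (by simp [q])⟩

theorem qLocal_mul_qInvLocal : qLocal * qInvLocal = 1 :=
  Subtype.ext (mul_inv_cancel₀ q_ne_zero)

theorem evalOne_qLocal : evalOne qLocal = 1 := by
  change RatFunc.eval _ _ RatFunc.X = 1
  simp

theorem evalOne_qInvLocal : evalOne qInvLocal = 1 := by
  have h := congrArg evalOne qLocal_mul_qInvLocal
  rwa [map_mul, evalOne_qLocal, one_mul, map_one] at h

theorem qSubOne_eq : qSubOne = qLocal - 1 := rfl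

theorem evalOne_qSubOne : evalOne qSubOne = 0 := by
  rw [qSubOne_eq, map_sub, evalOne_qLocal, map_one, sub_self]

theorem qSubOne_ne_zero : qSubOne ≠ 0 := by
  intro h
  have h1 : (q : Cq) = 1 := sub_eq_zero.1 (congrArg Subtype.val h)
  have h2 : algebraMap ℂ[X] Cq Polynomial.X = algebraMap ℂ[X] Cq 1 := by
    rw [map_one, RatFunc.algebraMap_X]; exact h1
  have h3 := congrArg (eval 0) (RatFunc.algebraMap_injective ℂ h2)
  simp at h3

/-- The numerator has the root `1`, and dividing it out leaves the denominator unchanged. -/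
theorem exists_eq_qSubOne_mul {f : regularAtOne} (h : evalOne f = 0) :
    ∃ g, f = qSubOne * g := by
  have hd : (f : Cq).denom.eval 1 ≠ 0 := f.2
  have hn : (f : Cq).num.eval 1 = 0 := by
    have h1 : (f : Cq).num.eval₂ (RingHom.id ℂ) 1 / (f : Cq).denom.eval₂ (RingHom.id ℂ) 1 = 0 := h
    simp only [eval₂_id] at h1
    exact (div_eq_zero_iff.1 h1).resolve_right hd
  obtain ⟨a, ha⟩ := dvd_iff_isRoot.2 hn
  refine ⟨⟨algebraMap ℂ[X] Cq a / algebraMap ℂ[X] Cq (f : Cq).denom,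
    mem_regularAtOne_of_eq_div hd rfl⟩, Subtype.ext ?_⟩
  change (f : Cq) = (q - 1) * _
  have h1 := (RatFunc.num_div_denom (f : Cq)).symm
  rw [ha, map_mul, mul_div_assoc] at h1
  refine h1.trans ?_
  simp [q]

theorem isUnit_of_evalOne_ne_zero {f : regularAtOne} (h : evalOne f ≠ 0) : IsUnit f := by
  have h0 : (f : Cq) ≠ 0 := fun h' => h (by
    rw [show f = 0 from Subtype.ext h', map_zero])
  have hn : (f : Cq).num.eval 1 ≠ 0 := fun hn => h (by
    have h1 : evalOne f = (f : Cq).num.eval₂ (RingHom.id ℂ) 1 /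
      (f : Cq).denom.eval₂ (RingHom.id ℂ) 1 := rfl
    rw [h1, eval₂_id, hn, zero_div])
  refine IsUnit.of_mul_eq_one ⟨(f : Cq)⁻¹, mem_regularAtOne_of_eq_div hn (a := (f : Cq).denom) ?_⟩
    (Subtype.ext (mul_inv_cancel₀ h0))
  rw [← inv_div, RatFunc.num_div_denom]

theorem span_qSubOne_le_jacobson :
    Ideal.span {qSubOne} ≤ Ideal.jacobson (⊥ : Ideal regularAtOne) := by
  rw [Ideal.span_singleton_le_iff_mem, Ideal.mem_jacobson_bot]
  intro f
  refine isUnit_of_evalOne_ne_zero ?_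
  rw [map_add, map_mul, evalOne_qSubOne, zero_mul, zero_add, map_one]
  exact one_ne_zero

end LocalRing

/-! ### Flat families over the local ring -/

section Deformation

variable {ι A : Type} [Ring A] [Algebra Cq A]

/-- The element `x i` of the integral form. -/
def integralGen (x : ι → A) (i : ι) : integralForm x :=
  ⟨x i, Algebra.subset_adjoin (Set.mem_range_self i)⟩

open Classical in
/-- Generators `x i` that commute modulo `q - 1` and satisfy no relations besides. -/
structure IsDeformation (x : ι → A) : Prop where
  adjoin_eq_top : Algebra.adjoin Cq (Set.range x) = ⊤
  commutator : ∀ i j, ∃ c ∈ Submodule.span regularAtOne (Set.range fun s : ι × ι => x s.1 * x s.2),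
    x j * x i - x i * x j = qSubOne • c
  functional : ∀ b : List ι, ∃ Λ : A →ₗ[Cq] Cq, ∃ c : ℂ, c ≠ 0 ∧ ∀ w : List ι, ∃ r : regularAtOne,
    Λ (w.map x).prod = r ∧ evalOne r = if w.Perm b then c else 0

section Monomials

variable {N : ℕ} (e : Fin N ≃ ι)

/-- The ordered word with the multiplicities `m`. -/
def orderedWord (m : ι → ℕ) : List ι :=
  (List.ofFn fun k : Fin N => List.replicate (m (e k)) (e k)).flatten

theorem orderedMonomial_eq {A : Type} [Monoid A] (x : ι → A) (m : ι → ℕ) :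
    orderedMonomial e x m = ((orderedWord e m).map x).prod := by
  simp [orderedMonomial, orderedWord, List.map_flatten, List.prod_flatten, List.map_ofFn,
    Function.comp_def]

theorem count_orderedWord [DecidableEq ι] (m : ι → ℕ) (i : ι) :
    (orderedWord e m).count i = m i := by
  rw [orderedWord, List.count_flatten, List.map_ofFn, List.sum_ofFn]
  simp only [Function.comp_apply, List.count_replicate]
  rw [Finset.sum_eq_single (e.symm i)]
  · simp
  · intro k _ hk
    rw [if_neg]
    rw [beq_iff_eq]
    rintro rfl
    simp at hk
  · simp

theorem orderedWord_perm_iff {m m' : ι → ℕ} :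
    (orderedWord e m).Perm (orderedWord e m') ↔ m = m' := by
  classical
  rw [List.perm_iff_count]
  simp only [count_orderedWord, funext_iff]

theorem perm_orderedWord [DecidableEq ι] (w : List ι) :
    w.Perm (orderedWord e fun i => w.count i) := by
  rw [List.perm_iff_count]
  simp only [count_orderedWord, implies_true]

end Monomials

variable {x : ι → A}

theorem IsDeformation.linearIndependent (hx : IsDeformation x) {N : ℕ} (e : Fin N ≃ ι) :
    LinearIndependent Cq (orderedMonomial e x) := by
  classical
  choose Λ c hc r hr hr' using hx.functional
  rw [linearIndependent_iff']
  intro s g hg m hm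
  -- Pairing the functionals of the ordered words with the ordered monomials gives a matrix that is
  -- diagonal and invertible at `q = 1`.
  let M : Matrix s s regularAtOne := fun b m => r (orderedWord e b) (orderedWord e m)
  have h1 : (M.map regularAtOne.subtype).mulVec (fun m => g m) = 0 := by
    ext b
    have h2 := congrArg (Λ (orderedWord e b)) hg
    rw [map_sum, map_zero, ← Finset.sum_coe_sort] at h2
    rw [Pi.zero_apply, ← h2]
    refine Finset.sum_congr rfl fun m _ => ?_
    rw [map_smul, orderedMonomial_eq, hr, smul_eq_mul, mul_comm]
    rfl
  have h2 : evalOne M.det ≠ 0 := by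
    have h3 : M.map evalOne = Matrix.diagonal fun b : s => c (orderedWord e b) := by
      ext b m
      rw [Matrix.map_apply, hr', Matrix.diagonal_apply]
      simp only [orderedWord_perm_iff, Subtype.ext_iff, eq_comm]
    rw [RingHom.map_det, RingHom.mapMatrix_apply, h3, Matrix.det_diagonal]
    exact Finset.prod_ne_zero_iff.2 fun b _ => hc _
  have h3 : (M.map regularAtOne.subtype).det ≠ 0 := by
    rw [← RingHom.mapMatrix_apply, ← RingHom.map_det]
    intro h
    have h0 : M.det = 0 := Subtype.ext h
    exact h2 (by rw [h0, map_zero])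
  exact congrFun (Matrix.eq_zero_of_mulVec_eq_zero h3 h1) ⟨m, hm⟩

/-- The span over the local ring of the words of length `d`. -/
def wordSpan (x : ι → A) (d : ℕ) : Submodule regularAtOne A :=
  Submodule.span regularAtOne {a | ∃ w : List ι, w.length = d ∧ a = (w.map x).prod}

theorem prod_map_mem_wordSpan (x : ι → A) (w : List ι) : (w.map x).prod ∈ wordSpan x w.length :=
  Submodule.subset_span ⟨w, rfl, rfl⟩

/-- The correction terms are quadratic, so reordering stays within words of the same length; this
keeps the module finitely generated for Nakayama's lemma. -/
theorem IsDeformation.prod_sub_prod_mem (hx : IsDeformation x) (u v : List ι) (i j : ι) :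
    ((u ++ j :: i :: v).map x).prod - ((u ++ i :: j :: v).map x).prod ∈
      Ideal.span {qSubOne} • wordSpan x (u.length + (v.length + 2)) := by
  obtain ⟨c, hc, h⟩ := hx.commutator i j
  have e1 : ((u ++ j :: i :: v).map x).prod - ((u ++ i :: j :: v).map x).prod =
      qSubOne • ((u.map x).prod * c * (v.map x).prod) := by
    rw [← smul_mul_assoc, ← mul_smul_comm, ← h]
    simp only [List.map_append, List.map_cons, List.prod_append, List.prod_cons]
    noncomm_ring
  rw [e1]
  refine Submodule.smul_mem_smul (Ideal.mem_span_singleton_self _) ?_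
  clear h e1
  induction hc using Submodule.span_induction with
  | mem a ha =>
    obtain ⟨⟨s, t⟩, rfl⟩ := ha
    refine Submodule.subset_span ⟨u ++ s :: t :: v, by simp, ?_⟩
    simp [mul_assoc]
  | zero => simp
  | add a b _ _ ha hb => rw [mul_add, add_mul]; exact add_mem ha hb
  | smul r a _ ha => rw [mul_smul_comm, smul_mul_assoc]; exact Submodule.smul_mem _ _ ha

theorem IsDeformation.prod_sub_prod_mem_of_perm (hx : IsDeformation x) {w w' : List ι}
    (h : w.Perm w') :
    (w.map x).prod - (w'.map x).prod ∈ Ideal.span {qSubOne} • wordSpan x w.length := by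
  suffices ∀ u : List ι, ((u ++ w).map x).prod - ((u ++ w').map x).prod ∈
      Ideal.span {qSubOne} • wordSpan x (u.length + w.length) by simpa using this []
  induction h with
  | nil => exact fun u => by simp
  | cons p _ ih =>
    intro u
    have := ih (u ++ [p])
    simpa [add_assoc, add_comm 1] using this
  | swap p r v => exact fun u => hx.prod_sub_prod_mem u v p r
  | trans h _ ih ih' =>
    intro u
    have := add_mem (ih u) (h.length_eq ▸ ih' u)
    rwa [sub_add_sub_cancel] at this

/-- Nakayama's lemma: modulo `q - 1` every word equals its sorted rearrangement, there are finitely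
many words of length `d`, and `q - 1` lies in the Jacobson radical. -/
theorem IsDeformation.wordSpan_le [Finite ι] (hx : IsDeformation x) {N : ℕ} (e : Fin N ≃ ι)
    (d : ℕ) :
    wordSpan x d ≤ Submodule.span regularAtOne (Set.range (orderedMonomial e x)) := by
  classical
  refine Submodule.le_of_le_smul_of_le_jacobson_bot ?_ span_qSubOne_le_jacobson ?_
  · refine Submodule.fg_span (((List.finite_length_eq ι d).image fun w => (w.map x).prod).subset ?_)
    rintro _ ⟨w, hw, rfl⟩
    exact ⟨w, hw, rfl⟩
  · refine Submodule.span_le.2 ?_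
    rintro _ ⟨w, rfl, rfl⟩
    have h := hx.prod_sub_prod_mem_of_perm (perm_orderedWord e w)
    rw [← orderedMonomial_eq] at h
    exact Submodule.mem_sup.2 ⟨_, Submodule.subset_span ⟨_, rfl⟩, _, h, add_sub_cancel _ _⟩

theorem exists_word_of_mem_closure {A : Type} [Monoid A] {x : ι → A} {a : A} (ha : a ∈ Submonoid.closure (Set.range x)) :
    ∃ w : List ι, a = (w.map x).prod := by
  induction ha using Submonoid.closure_induction with
  | mem a ha => obtain ⟨i, rfl⟩ := ha; exact ⟨[i], by simp⟩
  | one => exact ⟨[], by simp⟩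
  | mul a b _ _ ha hb =>
    obtain ⟨w, rfl⟩ := ha
    obtain ⟨w', rfl⟩ := hb
    exact ⟨w ++ w', by simp⟩

theorem IsDeformation.isPBW (hx : IsDeformation x) {N : ℕ} (e : Fin N ≃ ι) : IsPBW e x := by
  have : Finite ι := .of_equiv _ e
  refine ⟨hx.linearIndependent e, ?_⟩
  rw [eq_top_iff, ← Algebra.top_toSubmodule, ← hx.adjoin_eq_top, Algebra.adjoin_eq_span,
    Submodule.span_le]
  intro a ha
  obtain ⟨w, rfl⟩ := exists_word_of_mem_closure ha
  have h := hx.wordSpan_le e _ (prod_map_mem_wordSpan x w)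
  generalize (w.map x).prod = a at h ⊢
  induction h using Submodule.span_induction with
  | mem a ha => exact Submodule.subset_span ha
  | zero => exact zero_mem _
  | add a b _ _ ha hb => exact add_mem ha hb
  | smul r a _ ha => exact Submodule.smul_mem _ (r : Cq) ha

end Deformation

/-! ### Specialization of the integral form at `q = 1` and the induced Poisson bracket. -/

section ClassicalLimit

variable {ι A : Type} [Ring A] [Algebra Cq A]

/-- The presentation of the integral form by the free algebra. -/
def fromFree (x : ι → A) : FreeAlgebra regularAtOne ι →ₐ[regularAtOne] integralForm x :=
  FreeAlgebra.lift regularAtOne (integralGen x)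

theorem fromFree_surjective (x : ι → A) : Function.Surjective (fromFree x) := by
  have h : (integralForm x).val.comp (fromFree x) = FreeAlgebra.lift regularAtOne x := by
    ext i
    simp [fromFree, integralGen]
  intro a
  have ha : (a : A) ∈ (FreeAlgebra.lift regularAtOne x).range := by
    rw [← Algebra.adjoin_range_eq_range_freeAlgebra_lift]; exact a.2
  obtain ⟨u, hu⟩ := ha
  refine ⟨u, Subtype.ext ?_⟩
  rw [← h] at hu
  exact hu

/-- An induction principle for the integral form. -/
theorem integralForm_induction {x : ι → A} {C : integralForm x → Prop}
    (scalar : ∀ f, C (algebraMap regularAtOne (integralForm x) f))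
    (gen : ∀ i, C (integralGen x i)) (mul : ∀ a b, C a → C b → C (a * b))
    (add : ∀ a b, C a → C b → C (a + b)) (a : integralForm x) : C a := by
  obtain ⟨u, rfl⟩ := fromFree_surjective x a
  induction u using FreeAlgebra.induction with
  | grade0 f => rw [AlgHom.commutes]; exact scalar f
  | grade1 i => rw [fromFree, FreeAlgebra.lift_ι_apply]; exact gen i
  | mul u v hu hv => rw [map_mul]; exact mul _ _ hu hv
  | add u v hu hv => rw [map_add]; exact add _ _ hu hv

/-- The specialization at `q = 1` from the free algebra to polynomials. -/
def specialize (ι : Type) : FreeAlgebra regularAtOne ι →+* MvPolynomial ι ℂ :=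
  letI := ((MvPolynomial.C (σ := ι)).comp evalOne).toAlgebra
  (FreeAlgebra.lift regularAtOne (MvPolynomial.X (R := ℂ) (σ := ι))).toRingHom

theorem specialize_algebraMap (f : regularAtOne) :
    specialize ι (algebraMap _ _ f) = MvPolynomial.C (evalOne f) :=
  letI := ((MvPolynomial.C (σ := ι)).comp evalOne).toAlgebra
  (FreeAlgebra.lift regularAtOne (MvPolynomial.X (R := ℂ) (σ := ι))).commutes f

theorem specialize_ι (i : ι) : specialize ι (FreeAlgebra.ι _ i) = MvPolynomial.X i :=
  letI := ((MvPolynomial.C (σ := ι)).comp evalOne).toAlgebra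
  FreeAlgebra.lift_ι_apply (MvPolynomial.X (R := ℂ) (σ := ι)) i

theorem specialize_smul (f : regularAtOne) (u : FreeAlgebra regularAtOne ι) :
    specialize ι (f • u) = evalOne f • specialize ι u := by
  rw [Algebra.smul_def, map_mul, specialize_algebraMap, MvPolynomial.smul_eq_C_mul]

theorem prod_map_X [DecidableEq ι] (w : List ι) :
    (w.map fun i => (MvPolynomial.X i : MvPolynomial ι ℂ)).prod =
      MvPolynomial.monomial (Multiset.toFinsupp (w : Multiset ι)) 1 := by
  induction w with
  | nil => simp
  | cons i w ih =>
    rw [List.map_cons, List.prod_cons, ih, ← Multiset.cons_coe, ← Multiset.singleton_add, map_add,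
      Multiset.toFinsupp_singleton, MvPolynomial.X, MvPolynomial.monomial_mul, mul_one]

theorem fromFree_word (x : ι → A) (w : List ι) :
    (fromFree x (w.map (FreeAlgebra.ι regularAtOne)).prod : A) = (w.map x).prod := by
  rw [map_list_prod, List.map_map, ← Subalgebra.coe_val, map_list_prod, List.map_map]
  congr 2
  ext i
  simp [fromFree, integralGen]

variable {x : ι → A}

/-- Up to the nonzero factor `c`, the coefficient of the monomial `m` in the specialization of `u`
is the value at `q = 1` of a functional applied to the image of `u` in `A`. It therefore depends on
that image only. -/
theorem IsDeformation.specialize_eq_zero (hx : IsDeformation x)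
    {u : FreeAlgebra regularAtOne ι} (hu : fromFree x u = 0) : specialize ι u = 0 := by
  classical
  ext m
  rw [MvPolynomial.coeff_zero]
  obtain ⟨Λ, c, hc, hΛ⟩ := hx.functional (Finsupp.toMultiset m).toList
  have key : ∃ r : regularAtOne, Λ (fromFree x u) = r ∧
      evalOne r = c * (specialize ι u).coeff m := by
    clear hu
    have hu := (FreeAlgebra.basisFreeMonoid regularAtOne ι).mem_span u
    induction hu using Submodule.span_induction with
    | mem u hu =>
      obtain ⟨w, rfl⟩ := hu
      obtain ⟨r, hr, hr'⟩ := hΛ w.toList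
      refine ⟨r, by rw [basisFreeMonoid_apply, fromFree_word, hr], ?_⟩
      rw [hr', basisFreeMonoid_apply, map_list_prod, List.map_map]
      have e : ⇑(specialize ι) ∘ FreeAlgebra.ι regularAtOne = fun i => MvPolynomial.X i := by
        ext1 i; exact specialize_ι i
      rw [e, prod_map_X, MvPolynomial.coeff_monomial, mul_ite, mul_one, mul_zero]
      refine if_congr ?_ rfl rfl
      rw [← Multiset.coe_eq_coe, Multiset.coe_toList, ← Multiset.toFinsupp.injective.eq_iff,
        Finsupp.toMultiset_toFinsupp]
    | zero => exact ⟨0, by simp, by simp⟩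
    | add u v _ _ hu hv =>
      obtain ⟨r, hr, hr'⟩ := hu
      obtain ⟨s, hs, hs'⟩ := hv
      refine ⟨r + s, ?_, ?_⟩
      · rw [map_add, Subalgebra.coe_add, map_add, hr, hs]; rfl
      · rw [map_add, map_add, hr', hs', MvPolynomial.coeff_add, mul_add]
    | smul f u _ hu =>
      obtain ⟨r, hr, hr'⟩ := hu
      refine ⟨f * r, ?_, ?_⟩
      · rw [map_smul, Subalgebra.coe_smul]
        exact (map_smul Λ (f : Cq) _).trans (by rw [hr]; rfl)
      · rw [map_mul, hr', specialize_smul, MvPolynomial.coeff_smul, smul_eq_mul]; ring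
  obtain ⟨r, hr, hr'⟩ := key
  rw [hu, Subalgebra.coe_zero, map_zero] at hr
  have hr0 : r = 0 := Subtype.ext hr.symm
  rw [hr0, map_zero] at hr'
  exact (mul_eq_zero.1 hr'.symm).resolve_left hc

theorem IsDeformation.ker_fromFree_le (hx : IsDeformation x) :
    RingHom.ker (fromFree x).toRingHom ≤ RingHom.ker (specialize ι) :=
  fun _ hu => RingHom.mem_ker.2 (hx.specialize_eq_zero (RingHom.mem_ker.1 hu))

/-- The specialization at `q = 1` of the integral form. -/
def IsDeformation.limit (hx : IsDeformation x) : integralForm x →+* MvPolynomial ι ℂ :=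
  (fromFree x).toRingHom.liftOfRightInverse (Function.surjInv (fromFree_surjective x))
    (Function.rightInverse_surjInv (fromFree_surjective x)) ⟨specialize ι, hx.ker_fromFree_le⟩

theorem IsDeformation.limit_fromFree (hx : IsDeformation x) (u : FreeAlgebra regularAtOne ι) :
    hx.limit (fromFree x u) = specialize ι u :=
  (fromFree x).toRingHom.liftOfRightInverse_comp_apply (Function.surjInv (fromFree_surjective x))
    (Function.rightInverse_surjInv (fromFree_surjective x)) ⟨specialize ι, hx.ker_fromFree_le⟩ u

theorem IsDeformation.limit_algebraMap (hx : IsDeformation x) (f : regularAtOne) :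
    hx.limit (algebraMap regularAtOne (integralForm x) f) = MvPolynomial.C (evalOne f) := by
  rw [← (fromFree x).commutes, hx.limit_fromFree, specialize_algebraMap]

theorem IsDeformation.limit_gen (hx : IsDeformation x) (i : ι) :
    hx.limit (integralGen x i) = MvPolynomial.X i := by
  rw [← specialize_ι, ← hx.limit_fromFree, fromFree, FreeAlgebra.lift_ι_apply]

theorem IsDeformation.limit_smul (hx : IsDeformation x) (f : regularAtOne) (a : integralForm x) :
    hx.limit (f • a) = evalOne f • hx.limit a := by
  rw [Algebra.smul_def, map_mul, hx.limit_algebraMap, MvPolynomial.smul_eq_C_mul]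

theorem IsDeformation.limit_surjective (hx : IsDeformation x) :
    Function.Surjective hx.limit := by
  intro p
  induction p using MvPolynomial.induction_on with
  | C c => exact ⟨algebraMap _ _ (constant c), by rw [hx.limit_algebraMap, evalOne_constant]⟩
  | add p p' hp hp' =>
    obtain ⟨a, rfl⟩ := hp
    obtain ⟨b, rfl⟩ := hp'
    exact ⟨a + b, map_add _ _ _⟩
  | mul_X p i hp =>
    obtain ⟨a, rfl⟩ := hp
    exact ⟨a * integralGen x i, by rw [map_mul, hx.limit_gen]⟩

theorem qSubOne_smul_injective {a b : integralForm x} (h : qSubOne • a = qSubOne • b) : a = b := by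
  have h1 : (qSubOne : Cq) • (a : A) = (qSubOne : Cq) • (b : A) := congrArg Subtype.val h
  refine Subtype.ext (smul_right_injective A ?_ h1)
  exact fun h0 => qSubOne_ne_zero (Subtype.ext h0)

theorem exists_commutator_mul {a b b' : integralForm x} (h : ∃ c, b * a - a * b = qSubOne • c)
    (h' : ∃ c, b' * a - a * b' = qSubOne • c) :
    ∃ c, b * b' * a - a * (b * b') = qSubOne • c := by
  obtain ⟨c, hc⟩ := h
  obtain ⟨d, hd⟩ := h'
  refine ⟨c * b' + b * d, ?_⟩
  rw [smul_add, ← smul_mul_assoc, ← mul_smul_comm, ← hc, ← hd, sub_mul, mul_sub]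
  simp only [mul_assoc]
  abel

theorem IsDeformation.exists_commutator (hx : IsDeformation x) (a b : integralForm x) :
    ∃ c, b * a - a * b = qSubOne • c := by
  have symm {a b : integralForm x} (h : ∃ c, b * a - a * b = qSubOne • c) :
      ∃ c, a * b - b * a = qSubOne • c := by
    obtain ⟨c, hc⟩ := h
    exact ⟨-c, by rw [smul_neg, ← hc, neg_sub]⟩
  have step (a : integralForm x) (ha : ∀ i, ∃ c, integralGen x i * a - a * integralGen x i =
      qSubOne • c) (b : integralForm x) : ∃ c, b * a - a * b = qSubOne • c := by
    induction b using integralForm_induction with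
    | scalar f => exact ⟨0, by rw [smul_zero, Algebra.commutes f a, sub_self]⟩
    | gen i => exact ha i
    | mul b b' hb hb' => exact exists_commutator_mul hb hb'
    | add b b' hb hb' =>
      obtain ⟨c, hc⟩ := hb
      obtain ⟨d, hd⟩ := hb'
      exact ⟨c + d, by rw [smul_add, ← hc, ← hd]; noncomm_ring⟩
  refine step a (fun j => symm (step _ (fun i => ?_) a)) b
  obtain ⟨c, hc, h⟩ := hx.commutator j i
  have hc' : c ∈ integralForm x := by
    have : Submodule.span regularAtOne (Set.range fun s : ι × ι => x s.1 * x s.2) ≤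
        Subalgebra.toSubmodule (integralForm x) := by
      rw [Submodule.span_le]
      rintro _ ⟨s, rfl⟩
      exact (integralForm x).mul_mem (integralGen x s.1).2 (integralGen x s.2).2
    exact this hc
  exact ⟨⟨c, hc'⟩, Subtype.ext h⟩

/-- The ideal generated by `q - 1`. -/
def limitIdeal (x : ι → A) : Ideal (integralForm x) where
  carrier := {a | ∃ b, a = qSubOne • b}
  add_mem' := by
    rintro _ _ ⟨b, rfl⟩ ⟨c, rfl⟩
    exact ⟨b + c, (smul_add _ _ _).symm⟩
  zero_mem' := ⟨0, (smul_zero _).symm⟩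
  smul_mem' := by
    rintro c _ ⟨b, rfl⟩
    exact ⟨c * b, mul_smul_comm _ _ _⟩

instance (x : ι → A) : (limitIdeal x).IsTwoSided where
  mul_mem_of_left := by
    rintro _ c ⟨b, rfl⟩
    exact ⟨b * c, smul_mul_assoc _ _ _⟩

/-- The quotient by `q - 1` is commutative, so it receives a homomorphism `θ` from the polynomials.
Checking generators and scalars shows that `θ` composed with the limit is the quotient map, so the
kernel of the limit is no larger than the ideal. -/
theorem IsDeformation.limit_eq_zero_iff (hx : IsDeformation x) (a : integralForm x) :
    hx.limit a = 0 ↔ ∃ b, a = qSubOne • b := by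
  constructor
  swap
  · rintro ⟨b, rfl⟩
    rw [hx.limit_smul, evalOne_qSubOne, zero_smul]
  intro ha
  let π := Ideal.Quotient.mk (limitIdeal x)
  let _ : CommRing (integralForm x ⧸ limitIdeal x) :=
    { (inferInstance : Ring (integralForm x ⧸ limitIdeal x)) with
      mul_comm := fun a b => by
        obtain ⟨a, rfl⟩ := Ideal.Quotient.mk_surjective a
        obtain ⟨b, rfl⟩ := Ideal.Quotient.mk_surjective b
        rw [← map_mul, ← map_mul]
        exact Ideal.Quotient.eq.2 (hx.exists_commutator b a) }
  let θ : MvPolynomial ι ℂ →+* integralForm x ⧸ limitIdeal x :=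
    MvPolynomial.eval₂Hom (π.comp ((algebraMap regularAtOne (integralForm x)).comp constant))
      fun i => π (integralGen x i)
  have key (a : integralForm x) : θ (hx.limit a) = π a := by
    induction a using integralForm_induction with
    | scalar f =>
      rw [hx.limit_algebraMap, MvPolynomial.coe_eval₂Hom, MvPolynomial.eval₂_C]
      refine Ideal.Quotient.eq.2 ?_
      obtain ⟨g, hg⟩ := exists_eq_qSubOne_mul (f := constant (evalOne f) - f)
        (by rw [map_sub, evalOne_constant, sub_self])
      refine ⟨algebraMap _ _ g, ?_⟩
      rw [RingHom.comp_apply, ← map_sub, hg, map_mul, Algebra.smul_def]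
    | gen i => rw [hx.limit_gen, MvPolynomial.coe_eval₂Hom, MvPolynomial.eval₂_X]
    | mul a b ha hb => rw [map_mul, map_mul, ha, hb, map_mul]
    | add a b ha hb => rw [map_add, map_add, ha, hb, map_add]
  have h := key a
  rw [ha, map_zero] at h
  exact Ideal.Quotient.eq_zero_iff_mem.1 h.symm

variable {br : MvPolynomial ι ℂ →ₗ[ℂ] MvPolynomial ι ℂ →ₗ[ℂ] MvPolynomial ι ℂ}

/-- Both the bracket and the divided commutator obey the Leibniz rule in each argument, so agreement
on generators suffices. -/
theorem IsDeformation.bracket_limit (hx : IsDeformation x)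
    (left : ∀ a b c, br (a * b) c = a * br b c + b * br a c)
    (right : ∀ a b c, br a (b * c) = b * br a c + c * br a b)
    (gen : ∀ i j, ∃ c, integralGen x j * integralGen x i - integralGen x i * integralGen x j =
      qSubOne • c ∧ br (MvPolynomial.X i) (MvPolynomial.X j) = hx.limit c)
    (a b c : integralForm x) (h : b * a - a * b = qSubOne • c) :
    br (hx.limit a) (hx.limit b) = hx.limit c := by
  have left_C (r : ℂ) (c) : br (MvPolynomial.C r) c = 0 := by
    have h1 := left 1 1 c
    simp only [one_mul] at h1
    have h2 : br 1 c = 0 := by simpa using h1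
    rw [← mul_one (MvPolynomial.C r), ← MvPolynomial.smul_eq_C_mul, map_smul,
      LinearMap.smul_apply, h2, smul_zero]
  have right_C (r : ℂ) (c) : br c (MvPolynomial.C r) = 0 := by
    have h1 := right c 1 1
    simp only [one_mul] at h1
    have h2 : br c 1 = 0 := by simpa using h1
    rw [← mul_one (MvPolynomial.C r), ← MvPolynomial.smul_eq_C_mul, map_smul, h2, smul_zero]
  suffices ∃ d, b * a - a * b = qSubOne • d ∧ br (hx.limit a) (hx.limit b) = hx.limit d by
    obtain ⟨d, hd, h'⟩ := this
    rw [h', qSubOne_smul_injective (h.symm.trans hd)]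
  clear h c
  have step (a : integralForm x) (ha : ∀ j, ∃ d, integralGen x j * a - a * integralGen x j =
      qSubOne • d ∧ br (hx.limit a) (MvPolynomial.X j) = hx.limit d) (b : integralForm x) :
      ∃ d, b * a - a * b = qSubOne • d ∧ br (hx.limit a) (hx.limit b) = hx.limit d := by
    induction b using integralForm_induction with
    | scalar f =>
      refine ⟨0, by rw [smul_zero, Algebra.commutes f a, sub_self], ?_⟩
      rw [hx.limit_algebraMap, right_C, map_zero]
    | gen i => rw [hx.limit_gen]; exact ha i
    | mul b b' hb hb' =>
      obtain ⟨c, hc, hc'⟩ := hb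
      obtain ⟨d, hd, hd'⟩ := hb'
      refine ⟨c * b' + b * d, ?_, ?_⟩
      · rw [smul_add, ← smul_mul_assoc, ← mul_smul_comm, ← hc, ← hd, sub_mul, mul_sub]
        simp only [mul_assoc]
        abel
      · rw [map_mul, right, hc', hd', map_add, map_mul, map_mul]; ring
    | add b b' hb hb' =>
      obtain ⟨c, hc, hc'⟩ := hb
      obtain ⟨d, hd, hd'⟩ := hb'
      exact ⟨c + d, by rw [smul_add, ← hc, ← hd]; noncomm_ring, by
        rw [map_add, map_add, map_add, hc', hd']⟩
  refine step a (fun j => ?_) b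
  induction a using integralForm_induction with
  | scalar f =>
    refine ⟨0, by rw [smul_zero, Algebra.commutes f, sub_self], ?_⟩
    rw [hx.limit_algebraMap, left_C, map_zero]
  | gen i => rw [hx.limit_gen]; exact gen i j
  | mul b b' hb hb' =>
    obtain ⟨c, hc, hc'⟩ := hb
    obtain ⟨d, hd, hd'⟩ := hb'
    refine ⟨c * b' + b * d, ?_, ?_⟩
    · rw [smul_add, ← smul_mul_assoc, ← mul_smul_comm, ← hc, ← hd, sub_mul, mul_sub]
      simp only [mul_assoc]
      abel
    · rw [map_mul, left, hc', hd', map_add, map_mul, map_mul]; ring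
  | add b b' hb hb' =>
    obtain ⟨c, hc, hc'⟩ := hb
    obtain ⟨d, hd, hd'⟩ := hb'
    exact ⟨c + d, by rw [smul_add, ← hc, ← hd]; noncomm_ring, by
      rw [map_add, map_add, map_add, LinearMap.add_apply, hc', hd']⟩

theorem IsDeformation.isClassicalLimit (hx : IsDeformation x)
    (h : ∀ a b c : integralForm x, b * a - a * b = qSubOne • c →
      br (hx.limit a) (hx.limit b) = hx.limit c) : IsClassicalLimit x br :=
  ⟨hx.limit, hx.limit_algebraMap, hx.limit_gen, hx.limit_eq_zero_iff, h⟩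

theorem IsDeformation.isPoissonBracket (hx : IsDeformation x)
    (h : ∀ a b c : integralForm x, b * a - a * b = qSubOne • c →
      br (hx.limit a) (hx.limit b) = hx.limit c) : IsPoissonBracket br where
  skew a b := by
    obtain ⟨a, rfl⟩ := hx.limit_surjective a
    obtain ⟨b, rfl⟩ := hx.limit_surjective b
    obtain ⟨c, hc⟩ := hx.exists_commutator a b
    rw [h a b c hc, h b a (-c) (by rw [smul_neg, ← hc, neg_sub]), map_neg, neg_neg]
  leibniz a b b' := by
    obtain ⟨a, rfl⟩ := hx.limit_surjective a
    obtain ⟨b, rfl⟩ := hx.limit_surjective b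
    obtain ⟨b', rfl⟩ := hx.limit_surjective b'
    obtain ⟨c, hc⟩ := hx.exists_commutator a b
    obtain ⟨d, hd⟩ := hx.exists_commutator a b'
    rw [h a b c hc, h a b' d hd, ← map_mul, h a (b * b') (c * b' + b * d), map_add, map_mul,
      map_mul]
    rw [smul_add, ← smul_mul_assoc, ← mul_smul_comm, ← hc, ← hd, sub_mul, mul_sub]
    simp only [mul_assoc]
    abel
  jacobi a b c := by
    obtain ⟨a, rfl⟩ := hx.limit_surjective a
    obtain ⟨b, rfl⟩ := hx.limit_surjective b
    obtain ⟨c, rfl⟩ := hx.limit_surjective c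
    obtain ⟨d, hd⟩ := hx.exists_commutator b c
    obtain ⟨e, he⟩ := hx.exists_commutator c a
    obtain ⟨f, hf⟩ := hx.exists_commutator a b
    obtain ⟨d', hd'⟩ := hx.exists_commutator a d
    obtain ⟨e', he'⟩ := hx.exists_commutator b e
    obtain ⟨f', hf'⟩ := hx.exists_commutator c f
    rw [h b c d hd, h c a e he, h a b f hf, h a d d' hd', h b e e' he', h c f f' hf', ← map_add,
      ← map_add, ← map_zero hx.limit]
    -- The Jacobi identity for iterated commutators carries the factor `(q - 1) ^ 2`, which can be
    -- cancelled in the integral form.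
    refine congrArg hx.limit (qSubOne_smul_injective (qSubOne_smul_injective ?_))
    have expand {a b c d d' : integralForm x} (h : c * b - b * c = qSubOne • d)
        (h' : d * a - a * d = qSubOne • d') :
        qSubOne • qSubOne • d' = (c * b - b * c) * a - a * (c * b - b * c) := by
      rw [← h', smul_sub, ← smul_mul_assoc, ← mul_smul_comm, h]
    rw [smul_add, smul_add, smul_add, smul_add, expand hd hd', expand he he', expand hf hf',
      smul_zero, smul_zero]
    simp only [sub_mul, mul_sub, mul_assoc]
    abel

end ClassicalLimit

/-! ### The commutators of the generators -/

section Expansion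

variable {K M M' : Type*} [CommRing K] [AddCommGroup M] [Module K M] [AddCommGroup M'] [Module K M']
  {n : ℕ}

/-- Functions of words with four letters. -/
abbrev FourFun (n : ℕ) (M : Type*) : Type _ := Fin n → Fin n → Fin n → Fin n → M

/-- A deformation of the interchange of the letters 1 and 2. -/
def deform₁ (ε : K) (τ : Fin n → Fin n → K) (g : FourFun n M) : FourFun n M :=
  fun i j k l => g j i k l + (ε * τ i j) • g i j k l

/-- A deformation of the interchange of the letters 2 and 3. -/
def deform₂ (ε : K) (τ : Fin n → Fin n → K) (g : FourFun n M) : FourFun n M :=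
  fun i j k l => g i k j l + (ε * τ j k) • g i j k l

/-- A deformation of the interchange of the letters 3 and 4. -/
def deform₃ (ε : K) (τ : Fin n → Fin n → K) (g : FourFun n M) : FourFun n M :=
  fun i j k l => g i j l k + (ε * τ k l) • g i j k l

/-- The coefficient of `ε` in the expansion of `Ψ` around `ε = 0`. -/
def expansion (ε η : K) (τ : Fin n → Fin n → K) (g : FourFun n M) : FourFun n M :=
  fun i j k l =>
    τ j k • deform₃ ε τ (deform₁ ε τ (deform₂ ε τ g)) i j k l
    + τ j l • deform₁ ε τ (deform₂ ε τ g) i k j l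
    + τ i k • deform₂ ε τ g i k l j
    + τ i l • g k i l j
    + η • (deform₁ ε τ (deform₂ ε τ (deform₁ ε τ g)) i j k l
      + deform₂ ε τ (deform₃ ε τ (deform₁ ε τ g)) i j k l)
    + (ε * η ^ 2) • deform₂ ε τ (deform₁ ε τ g) i j k l

theorem map_expansion (f : M →ₗ[K] M') (ε η : K) (τ : Fin n → Fin n → K) (g : FourFun n M)
    (i j k l : Fin n) :
    f (expansion ε η τ g i j k l) = expansion ε η τ (fun a b c d => f (g a b c d)) i j k l := by
  simp only [expansion, deform₁, deform₂, deform₃, map_add, map_smul]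

/-- Each `P` is an interchange plus a term with `ε`. In the fourfold product these terms are split
off one factor at a time, starting from the rightmost, on letters that the earlier factors have
already interchanged. -/
theorem map_apply_eq_add_expansion {N : Type*} [AddCommMonoid N] [Module K N] {ε η : K} {τ : Fin n → Fin n → K} {P₁ P₂ P₃ : Module.End K N}
    {e : FourFun n N} (h₁ : ∀ i j k l, P₁ (e i j k l) = e j i k l + (ε * τ i j) • e i j k l)
    (h₂ : ∀ i j k l, P₂ (e i j k l) = e i k j l + (ε * τ j k) • e i j k l)
    (h₃ : ∀ i j k l, P₃ (e i j k l) = e i j l k + (ε * τ k l) • e i j k l)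
    (f : N →ₗ[K] M) (i j k l : Fin n) :
    f ((P₂ * P₁ * P₃ * P₂ + (ε * η) • (P₁ * P₂ * P₁ + P₁ * P₃ * P₂) + (ε * η) ^ 2 • (P₁ * P₂))
      (e i j k l)) =
      f (e k l i j) + ε • expansion ε η τ (fun a b c d => f (e a b c d)) i j k l := by
  simp only [LinearMap.add_apply, LinearMap.smul_apply, Module.End.mul_apply, map_add, map_smul,
    h₁, h₂, h₃, expansion, deform₁, deform₂, deform₃]
  module

/-- The deviation of the braiding from the interchange of letters, divided by `q - 1`. -/
def tau (i j : Fin n) : regularAtOne :=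
  if i = j then -qInvLocal else if i < j then 0 else -(1 + qInvLocal)

/-- The quotient of `q - q⁻¹` by `q - 1`. -/
def eta : regularAtOne := 1 + qInvLocal

theorem coe_qSubOne : (qSubOne : Cq) = q - 1 := rfl

theorem coe_qInvLocal : (qInvLocal : Cq) = q⁻¹ := rfl

theorem qSubOne_mul_eta : (qSubOne : Cq) * (eta : Cq) = q - q⁻¹ := by
  rw [eta, Subring.coe_add, Subring.coe_one, coe_qSubOne, coe_qInvLocal]
  have := mul_inv_cancel₀ q_ne_zero
  linear_combination this

theorem ite_eq_add_smul {M : Type*} [AddCommMonoid M] [Module Cq M] {i j : Fin n} {a b : M}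
    (hab : i = j → a = b) :
    (if i = j then q⁻¹ • b else if i < j then a else a + (q⁻¹ - q) • b) =
      a + ((qSubOne : Cq) * (tau i j : Cq)) • b := by
  rw [tau]
  split_ifs with h1 h2
  · have : q⁻¹ = 1 + (qSubOne : Cq) * ((-qInvLocal : regularAtOne) : Cq) := by
      rw [Subring.coe_neg, coe_qSubOne, coe_qInvLocal]
      linear_combination mul_inv_cancel₀ q_ne_zero
    rw [this, add_smul, one_smul, hab h1]
  · simp
  · rw [← eta, Subring.coe_neg, mul_neg, qSubOne_mul_eta, neg_sub]

theorem T_basisVV_eq (i j : Fin n) : T n (basisVV n (i, j)) =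
    basisVV n (j, i) + ((qSubOne : Cq) * (tau i j : Cq)) • basisVV n (i, j) :=
  (T_basisVV (i, j)).trans (ite_eq_add_smul fun h => by dsimp only at h; rw [h])

/-- The vectors of the basis of `V^{⊗4}`. -/
def basisV4 (i j k l : Fin n) : V4 n := basisVV n (i, j) ⊗ₜ basisVV n (k, l)

theorem Psi1_basisV4 (i j k l : Fin n) : Psi1 n (basisV4 i j k l) =
    basisV4 j i k l + ((qSubOne : Cq) * (tau i j : Cq)) • basisV4 i j k l := by
  rw [basisV4, Psi1, TensorProduct.map_tmul, T_basisVV_eq, TensorProduct.add_tmul,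
    ← TensorProduct.smul_tmul']
  rfl

theorem Psi3_basisV4 (i j k l : Fin n) : Psi3 n (basisV4 i j k l) =
    basisV4 i j l k + ((qSubOne : Cq) * (tau k l : Cq)) • basisV4 i j k l := by
  rw [basisV4, Psi3, TensorProduct.map_tmul, T_basisVV_eq, TensorProduct.tmul_add,
    TensorProduct.tmul_smul]
  rfl

theorem Psi2_basisV4 (i j k l : Fin n) : Psi2 n (basisV4 i j k l) =
    basisV4 i k j l + ((qSubOne : Cq) * (tau j k : Cq)) • basisV4 i j k l :=
  (Psi2_basis i j k l).trans (ite_eq_add_smul fun h => by subst h; rfl)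

theorem map_Psi_basisV4 {M : Type*} [AddCommGroup M] [Module Cq M] (f : V4 n →ₗ[Cq] M)
    (i j k l : Fin n) :
    f (Psi n (basisV4 i j k l)) = f (basisV4 k l i j) + (qSubOne : Cq) •
      expansion (qSubOne : Cq) (eta : Cq) (fun a b => (tau a b : Cq))
        (fun a b c d => f (basisV4 a b c d)) i j k l := by
  rw [Psi, ← qSubOne_mul_eta]
  exact map_apply_eq_add_expansion Psi1_basisV4 Psi2_basisV4 Psi3_basisV4 f i j k l

theorem coe_expansion {M : Type*} [AddCommGroup M] [Module Cq M] (g : FourFun n M)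
    (i j k l : Fin n) :
    expansion (qSubOne : Cq) (eta : Cq) (fun a b => (tau a b : Cq)) g i j k l =
      expansion qSubOne eta tau g i j k l := by
  simp only [expansion, deform₁, deform₂, deform₃, Subring.smul_def, Subring.coe_mul,
    Subring.coe_pow]

theorem x_mul_x (i j k l : Fin n) : x n (i, j) * x n (k, l) = x n (k, l) * x n (i, j) +
    qSubOne • expansion qSubOne eta tau (fun a b c d => x n (a, b) * x n (c, d)) i j k l := by
  let μ : V4 n →ₗ[Cq] Sq n := (RingQuot.mkAlgHom Cq (SqRel n)).toLinearMap ∘ₗ degTwo n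
  have hμ (a b c d : Fin n) : μ (basisV4 a b c d) = x n (a, b) * x n (c, d) := by
    simp [μ, degTwo, basisV4, x]
  have h : μ (Psi n (basisV4 i j k l)) = μ (basisV4 i j k l) :=
    RingQuot.mkAlgHom_rel Cq (SqRel.mk _)
  rw [map_Psi_basisV4, coe_expansion] at h
  simp only [hμ] at h
  exact h.symm

end Expansion

/-! ### `S_q(V ⊗ V)` as a deformation, and its bracket. -/

section Deformation

variable {n : ℕ}

theorem x_mul_x_sub (i j k l : Fin n) : x n (k, l) * x n (i, j) - x n (i, j) * x n (k, l) =
    qSubOne •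
      -expansion qSubOne eta tau (fun a b c d => x n (a, b) * x n (c, d)) i j k l := by
  rw [x_mul_x i j k l, smul_neg, sub_add_cancel_left]

theorem isDeformation (n : ℕ) : IsDeformation (x n) where
  adjoin_eq_top := by
    rw [eq_top_iff]
    rintro a -
    obtain ⟨t, rfl⟩ := RingQuot.mkAlgHom_surjective Cq (SqRel n) a
    have ht := (basisVV n).tensorAlgebra.mem_span t
    induction ht using Submodule.span_induction with
    | mem t ht =>
      obtain ⟨w, rfl⟩ := ht
      rw [tensorAlgebra_basis_apply, mkAlgHom_tensorWord]
      refine list_prod_mem fun a ha => ?_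
      obtain ⟨p, -, rfl⟩ := List.mem_map.1 ha
      exact Algebra.subset_adjoin ⟨p, rfl⟩
    | zero => rw [map_zero]; exact zero_mem _
    | add t t' _ _ h h' => rw [map_add]; exact add_mem h h'
    | smul c t _ h => rw [map_smul]; exact Subalgebra.smul_mem _ h c
  commutator := by
    rintro ⟨i, j⟩ ⟨k, l⟩
    refine ⟨_, ?_, x_mul_x_sub i j k l⟩
    let S := Submodule.span regularAtOne
      (Set.range fun s : (Fin n × Fin n) × (Fin n × Fin n) => x n s.1 * x n s.2)
    -- The expansion is linear in its last function, so computing it inside the submodule shows that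
    -- it lies there.
    let g : FourFun n S := fun a b c d =>
      ⟨x n (a, b) * x n (c, d), Submodule.subset_span ⟨((a, b), (c, d)), rfl⟩⟩
    exact neg_mem (map_expansion S.subtype qSubOne eta tau g i j k l ▸ Subtype.prop _)
  functional b := by
    obtain ⟨Λ, hΛ⟩ := exists_functional b
    -- Carrying out the same construction over the local ring shows that the values of `Λ` on words
    -- are defined at `q = 1`.
    refine ⟨Λ, wordForm 1 1 b b, wordForm_one_self_ne_zero b, fun w =>
      ⟨wordForm qLocal qInvLocal b w, ?_, ?_⟩⟩
    · rw [hΛ]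
      exact (map_wordForm regularAtOne.subtype qLocal qInvLocal b w).symm
    · rw [map_wordForm, evalOne_qLocal, evalOne_qInvLocal]
      split_ifs with h
      · exact wordForm_one_perm b h
      · exact wordForm_one_eq_zero h

theorem integralGen_mul_sub (i j k l : Fin n) :
    integralGen (x n) (k, l) * integralGen (x n) (i, j) -
      integralGen (x n) (i, j) * integralGen (x n) (k, l) = qSubOne •
        -expansion qSubOne eta tau
          (fun a b c d => integralGen (x n) (a, b) * integralGen (x n) (c, d)) i j k l := by
  refine Subtype.ext ((x_mul_x_sub i j k l).trans ?_)
  rw [← Subalgebra.coe_val, map_smul, map_neg]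
  congr 2

/-! ### The bracket -/

/-- The bracket of the variables `X i j` and `X k l`. -/
def genBracket (i j k l : Fin n) : SVV n :=
  (1 + sgn j k) • (X i k * X j l) + (sgn i k + sgn j l) • (X i l * X k j)
    + (sgn i l - 1) • (X k i * X l j)

theorem evalOne_tau (i j : Fin n) : evalOne (tau i j) = -(1 + sgn i j) := by
  rcases lt_trichotomy i j with h | rfl | h
  · simp [tau, sgn, h, h.ne, h.not_gt]
  · simp [tau, sgn, evalOne_qInvLocal]
  · simp [tau, sgn, evalOne_qInvLocal, h, h.ne', h.not_gt]

theorem limit_expansion (i j k l : Fin n) :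
    (isDeformation n).limit (-expansion qSubOne eta tau
      (fun a b c d => integralGen (x n) (a, b) * integralGen (x n) (c, d)) i j k l) =
        genBracket i j k l := by
  have h2 : evalOne eta = 2 := by rw [eta, map_add, map_one, evalOne_qInvLocal]; norm_num
  simp only [expansion, deform₁, deform₂, deform₃, map_neg, map_add, map_mul,
    IsDeformation.limit_smul, IsDeformation.limit_gen, evalOne_qSubOne, zero_mul, zero_smul,
    add_zero, evalOne_tau, h2, genBracket]
  simp only [MvPolynomial.smul_eq_C_mul, map_neg, map_add, map_sub, map_one]
  have : (MvPolynomial.C 2 : SVV n) = 2 := rfl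
  rw [this]
  ring

/-- The bracket on `S(V ⊗ V)`. -/
def bracket (n : ℕ) : SVV n →ₗ[ℂ] SVV n →ₗ[ℂ] SVV n where
  toFun a := (MvPolynomial.mkDerivation ℂ (fun p : Fin n × Fin n =>
    MvPolynomial.mkDerivation ℂ fun r : Fin n × Fin n => genBracket p.1 p.2 r.1 r.2) a).toLinearMap
  map_add' a b := by rw [map_add]; rfl
  map_smul' c a := by rw [Derivation.map_smul]; rfl

theorem bracket_X (i j k l : Fin n) : bracket n (X i j) (X k l) = genBracket i j k l := by
  simp [bracket]

theorem bracket_mul_left (a b c : SVV n) :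
    bracket n (a * b) c = a * bracket n b c + b * bracket n a c := by
  simp [bracket]

theorem bracket_mul_right (a b c : SVV n) :
    bracket n a (b * c) = b * bracket n a c + c * bracket n a b := by
  simp [bracket]

theorem bracket_limit (a b c : integralForm (x n)) (h : b * a - a * b = qSubOne • c) :
    bracket n ((isDeformation n).limit a) ((isDeformation n).limit b) =
      (isDeformation n).limit c :=
  (isDeformation n).bracket_limit bracket_mul_left bracket_mul_right
    (fun p r => ⟨_, integralGen_mul_sub p.1 p.2 r.1 r.2, by
      rw [limit_expansion]; exact bracket_X _ _ _ _⟩) a b c h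

theorem isPoissonBracket_bracket (n : ℕ) : IsPoissonBracket (bracket n) :=
  (isDeformation n).isPoissonBracket bracket_limit

theorem isClassicalLimit_bracket (n : ℕ) : IsClassicalLimit (x n) (bracket n) :=
  (isDeformation n).isClassicalLimit bracket_limit

end Deformation

/-! ### The list of quadratic formulae, and uniqueness. -/

section Formulae

variable {n : ℕ}

theorem sgn_self (i : Fin n) : sgn i i = 0 := by simp [sgn]

theorem sgn_of_lt {i j : Fin n} (h : i < j) : sgn i j = -1 := by simp [sgn, h, h.not_gt]

theorem sgn_of_gt {i j : Fin n} (h : j < i) : sgn i j = 1 := by simp [sgn, h]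

theorem δ_self (i : Fin n) : δ i i = 1 := if_pos rfl

theorem δ_of_ne {i j : Fin n} (h : i ≠ j) : δ i j = 0 := if_neg h

theorem quadraticFormulae_bracket (n : ℕ) : QuadraticFormulae n (bracket n) := by
  intro i j k l hij hjk hkl
  simp only [bracket_X, genBracket, MvPolynomial.smul_eq_C_mul, map_add, map_sub, map_one]
  -- Once each inequality is an equality or strict, all signs and Kronecker symbols are constants
  -- and the formulae are polynomial identities.
  rcases hij.eq_or_lt with rfl | hij <;> rcases hjk.eq_or_lt with rfl | hjk <;>
  rcases hkl.eq_or_lt with rfl | hkl <;>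
  (try have hik := hij.trans hjk
   try have hjl := hjk.trans hkl
   try have hil := hij.trans hkl
   try have hil := hik.trans hkl
   simp only [sgn_self, sgn_of_lt, sgn_of_gt, δ_self, δ_of_ne, ne_of_lt, ne_eq, not_false_eq_true,
      map_neg, map_one, map_zero, *]
   refine ⟨?_, ?_, ?_, ?_, ?_, ?_, ?_, ?_, ?_, ?_, ?_, ?_⟩ <;> ring1)

end Formulae

/-- The twelve patterns place the two pairs side by side, interlaced or nested, with either
orientation of each pair; up to exchanging the pairs, every quadruple of indices is of this kind. -/
theorem sorted_induction {n : ℕ} {Z : Fin n → Fin n → Fin n → Fin n → Prop}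
    (symm : ∀ a b c d, Z a b c d → Z c d a b)
    (sorted : ∀ i j k l, i ≤ j → j ≤ k → k ≤ l →
      Z i j k l ∧ Z i j l k ∧ Z j i k l ∧ Z j i l k ∧ Z i k j l ∧ Z i k l j ∧ Z k i j l ∧
      Z k i l j ∧ Z i l j k ∧ Z i l k j ∧ Z l i k j ∧ Z l i j k) (a b c d : Fin n) :
    Z a b c d := by
  have main (a b c d : Fin n) (hab : a ≤ b) (hcd : c ≤ d) (hac : a ≤ c) :
      Z a b c d ∧ Z b a c d ∧ Z a b d c ∧ Z b a d c := by
    rcases le_total b c with hbc | hbc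
    · obtain ⟨h1, h2, h3, h4, -⟩ := sorted a b c d hab hbc hcd
      exact ⟨h1, h3, h2, h4⟩
    · rcases le_total b d with hbd | hbd
      · obtain ⟨-, -, -, -, h1, h2, h3, h4, -⟩ := sorted a c b d hac hbc hbd
        exact ⟨h1, h3, h2, h4⟩
      · obtain ⟨-, -, -, -, -, -, -, -, h1, h2, h3, h4⟩ := sorted a c d b hac hcd hbd
        exact ⟨h1, h4, h2, h3⟩
  have main' (a b c d : Fin n) (hab : a ≤ b) (hcd : c ≤ d) :
      Z a b c d ∧ Z b a c d ∧ Z a b d c ∧ Z b a d c := by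
    rcases le_total a c with hac | hac
    · exact main a b c d hab hcd hac
    · obtain ⟨h1, h2, h3, h4⟩ := main c d a b hcd hab hac
      exact ⟨symm _ _ _ _ h1, symm _ _ _ _ h3, symm _ _ _ _ h2, symm _ _ _ _ h4⟩
  rcases le_total a b with hab | hab <;> rcases le_total c d with hcd | hcd
  · exact (main' a b c d hab hcd).1
  · exact (main' a b d c hab hcd).2.2.1
  · exact (main' b a c d hab hcd).2.1
  · exact (main' b a d c hab hcd).2.2.2

/-! ### Skew biderivations -/

section Biderivation

variable {P Q : Type} [CommRing P] [Algebra ℂ P] [CommRing Q] [Algebra ℂ Q]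
  {br : P →ₗ[ℂ] P →ₗ[ℂ] P}

theorem IsSkewBiderivation.leibniz_left (h : IsSkewBiderivation br) (a b c : P) :
    br (a * b) c = br a c * b + a * br b c := by
  rw [h.skew, h.leibniz, h.skew c a, h.skew c b]; ring

theorem IsSkewBiderivation.one_right (h : IsSkewBiderivation br) (a : P) : br a 1 = 0 := by
  have := h.leibniz a 1 1
  simpa using this

variable {σ : Type} {br br' : MvPolynomial σ ℂ →ₗ[ℂ] MvPolynomial σ ℂ →ₗ[ℂ] MvPolynomial σ ℂ}

/-- Elements that a homomorphism kills after bracketing with the variables. -/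
theorem IsSkewBiderivation.map_eq_zero (h : IsSkewBiderivation br)
    (φ : MvPolynomial σ ℂ →ₐ[ℂ] Q) {a : MvPolynomial σ ℂ}
    (ha : ∀ i, φ (br a (MvPolynomial.X i)) = 0) (b : MvPolynomial σ ℂ) : φ (br a b) = 0 := by
  induction b using MvPolynomial.induction_on with
  | C c =>
    rw [← mul_one (MvPolynomial.C c), ← MvPolynomial.smul_eq_C_mul, map_smul, h.one_right,
      smul_zero, map_zero]
  | add p p' hp hp' => rw [map_add, map_add, hp, hp', add_zero]
  | mul_X p i hp => rw [h.leibniz, map_add, map_mul, map_mul, hp, ha, zero_mul, mul_zero, add_zero]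

theorem IsSkewBiderivation.sub (h : IsSkewBiderivation br) (h' : IsSkewBiderivation br') :
    IsSkewBiderivation (br - br') where
  skew a b := by simp only [LinearMap.sub_apply, h.skew a b, h'.skew a b]; ring
  leibniz a b c := by simp only [LinearMap.sub_apply, h.leibniz, h'.leibniz]; ring

theorem IsSkewBiderivation.ext (h : IsSkewBiderivation br) (h' : IsSkewBiderivation br')
    (hX : ∀ i j, br (MvPolynomial.X i) (MvPolynomial.X j) =
      br' (MvPolynomial.X i) (MvPolynomial.X j)) : br = br' := by
  rw [← sub_eq_zero]
  have hs := h.sub h'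
  refine LinearMap.ext fun a => LinearMap.ext fun b => ?_
  refine hs.map_eq_zero (AlgHom.id ℂ _) (fun i => ?_) b
  rw [AlgHom.id_apply, hs.skew, neg_eq_zero]
  refine hs.map_eq_zero (AlgHom.id ℂ _) (fun j => ?_) a
  rw [AlgHom.id_apply, LinearMap.sub_apply, LinearMap.sub_apply, hX, sub_self]

end Biderivation

theorem eq_bracket_of_quadraticFormulae {n : ℕ} {br : SVV n →ₗ[ℂ] SVV n →ₗ[ℂ] SVV n}
    (h : IsSkewBiderivation br) (hq : QuadraticFormulae n br) : br = bracket n := by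
  have hb := (isPoissonBracket_bracket n).toIsSkewBiderivation
  refine h.ext hb fun ⟨a, b⟩ ⟨c, d⟩ => ?_
  refine sorted_induction (Z := fun a b c d => br (X a b) (X c d) = bracket n (X a b) (X c d))
    (fun a b c d h1 => ?_) (fun i j k l hij hjk hkl => ?_) a b c d
  · rw [h.skew, hb.skew, h1]
  · have h1 := hq i j k l hij hjk hkl
    have h2 := quadraticFormulae_bracket n i j k l hij hjk hkl
    simp only [h1, h2, and_self]

/-! ### Quotients -/

section Quotient

variable {σ τ : Type} {br : MvPolynomial σ ℂ →ₗ[ℂ] MvPolynomial σ ℂ →ₗ[ℂ] MvPolynomial σ ℂ}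

/-- The kernel of a split homomorphism of polynomial algebras. -/
theorem ker_eq_of_section {φ : MvPolynomial σ ℂ →ₐ[ℂ] MvPolynomial τ ℂ}
    {s : MvPolynomial τ ℂ →ₐ[ℂ] MvPolynomial σ ℂ} {I : Ideal (MvPolynomial σ ℂ)}
    (hI : I ≤ RingHom.ker φ)
    (hs : ∀ i, MvPolynomial.X i - s (φ (MvPolynomial.X i)) ∈ I) : RingHom.ker φ = I := by
  refine le_antisymm (fun a ha => ?_) hI
  have h : (Ideal.Quotient.mkₐ ℂ I).comp (s.comp φ) = Ideal.Quotient.mkₐ ℂ I := by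
    refine MvPolynomial.algHom_ext fun i => ?_
    exact (Ideal.Quotient.eq.2 (hs i)).symm
  have h1 := AlgHom.congr_fun h a
  rw [AlgHom.comp_apply, AlgHom.comp_apply, RingHom.mem_ker.1 ha, map_zero, map_zero] at h1
  exact Ideal.Quotient.eq_zero_iff_mem.1 h1.symm

/-- The bracket on the target of a homomorphism `φ` with the section `s`. -/
def quotientBracket (br : MvPolynomial σ ℂ →ₗ[ℂ] MvPolynomial σ ℂ →ₗ[ℂ] MvPolynomial σ ℂ)
    (φ : MvPolynomial σ ℂ →ₐ[ℂ] MvPolynomial τ ℂ) (s : MvPolynomial τ ℂ →ₐ[ℂ] MvPolynomial σ ℂ) :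
    MvPolynomial τ ℂ →ₗ[ℂ] MvPolynomial τ ℂ →ₗ[ℂ] MvPolynomial τ ℂ :=
  (br.compl₁₂ s.toLinearMap s.toLinearMap).compr₂ φ.toLinearMap

variable {φ : MvPolynomial σ ℂ →ₐ[ℂ] MvPolynomial τ ℂ}
  {s : MvPolynomial τ ℂ →ₐ[ℂ] MvPolynomial σ ℂ}

/-- By the Leibniz rule it suffices to bracket generators of the ideal with variables. -/
theorem isPoissonIdeal_ker_of_forall_X (hbr : IsSkewBiderivation br) {S : Set (MvPolynomial σ ℂ)}
    (hS : RingHom.ker φ = Ideal.span S)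
    (h : ∀ a ∈ S, ∀ i, φ (br a (MvPolynomial.X i)) = 0) : IsPoissonIdeal br (RingHom.ker φ) := by
  intro a ha b
  rw [RingHom.mem_ker]
  have ha' := ha
  rw [hS] at ha'
  induction ha' using Submodule.span_induction with
  | mem a hm => exact hbr.map_eq_zero φ (h a hm) b
  | zero => rw [map_zero, LinearMap.zero_apply, map_zero]
  | add a a' hm hm' h1 h2 =>
    rw [map_add, LinearMap.add_apply, map_add, h1 (hS ▸ hm), h2 (hS ▸ hm'), add_zero]
  | smul c a hm h1 =>
    rw [smul_eq_mul, hbr.leibniz_left, map_add, map_mul, map_mul, h1 (hS ▸ hm),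
      RingHom.mem_ker.1 (hS ▸ hm : a ∈ RingHom.ker φ), mul_zero, mul_zero, add_zero]

/-- Replacing an argument by its image under `s ∘ φ` changes it by an element of the Poisson ideal,
so the bracket computed through the section is the induced one. -/
theorem lifts_quotientBracket (hbr : IsSkewBiderivation br) (hs : φ.comp s = AlgHom.id ℂ _)
    (hφ : IsPoissonIdeal br (RingHom.ker φ)) : Lifts φ br (quotientBracket br φ s) := by
  have hs' (a : MvPolynomial τ ℂ) : φ (s a) = a := AlgHom.congr_fun hs a
  refine ⟨fun a => ⟨s a, hs' a⟩, fun a b => ?_⟩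
  have hmem (a) : a - s (φ a) ∈ RingHom.ker φ := by
    rw [RingHom.mem_ker, map_sub, hs', sub_self]
  have h1 := RingHom.mem_ker.1 (hφ _ (hmem a) b)
  have h2 := RingHom.mem_ker.1 (hφ _ (hmem b) (s (φ a)))
  rw [map_sub, LinearMap.sub_apply, map_sub, sub_eq_zero] at h1
  rw [hbr.skew, map_sub, map_neg, map_sub, neg_eq_zero, sub_eq_zero] at h2
  exact h1.trans h2

theorem isPoissonBracket_of_lifts (hbr : IsPoissonBracket br)
    {br' : MvPolynomial τ ℂ →ₗ[ℂ] MvPolynomial τ ℂ →ₗ[ℂ] MvPolynomial τ ℂ}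
    (h : Lifts φ br br') : IsPoissonBracket br' where
  skew a b := by
    obtain ⟨a, rfl⟩ := h.1 a
    obtain ⟨b, rfl⟩ := h.1 b
    rw [← h.2, ← h.2, hbr.skew, map_neg]
  leibniz a b c := by
    obtain ⟨a, rfl⟩ := h.1 a
    obtain ⟨b, rfl⟩ := h.1 b
    obtain ⟨c, rfl⟩ := h.1 c
    rw [← map_mul, ← h.2, ← h.2, ← h.2, hbr.leibniz, map_add, map_mul, map_mul]
  jacobi a b c := by
    obtain ⟨a, rfl⟩ := h.1 a
    obtain ⟨b, rfl⟩ := h.1 b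
    obtain ⟨c, rfl⟩ := h.1 c
    simp only [← h.2, ← map_add, hbr.jacobi, map_zero]

end Quotient

/-! ### The quotient `S(S²V)`. -/

section Symmetric

variable {n : ℕ}

theorem toSym_X (i j : Fin n) : toSym n (X i j) = symY i j := by simp [toSym]

theorem symY_comm (i j : Fin n) : symY i j = symY j i := by
  rw [symY, symY, Sym2.eq_swap]

/-- A section of the projection `S(V ⊗ V) → S(S²V)`. -/
def symSection (n : ℕ) : SSym n →ₐ[ℂ] SVV n :=
  MvPolynomial.aeval fun z => X z.inf z.sup

theorem toSym_comp_symSection : (toSym n).comp (symSection n) = AlgHom.id ℂ _ := by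
  refine MvPolynomial.algHom_ext fun z => ?_
  rw [AlgHom.comp_apply, symSection, MvPolynomial.aeval_X, toSym_X, AlgHom.id_apply, symY]
  congr 1
  induction z with | _ i j => ?_
  rcases le_total i j with h | h
  · simp [h]
  · simp [h, Sym2.eq_swap]

theorem ker_toSym : RingHom.ker (toSym n) = idealAlt n := by
  refine ker_eq_of_section (s := symSection n) ?_ fun ⟨i, j⟩ => ?_
  · rw [idealAlt, Ideal.span_le]
    rintro _ ⟨p, rfl⟩
    simp only [SetLike.mem_coe, RingHom.mem_ker, map_sub, toSym_X, symY_comm p.1, sub_self]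
  · rw [toSym_X, symY, symSection, MvPolynomial.aeval_X]
    rcases le_total i j with h | h
    · simp [h]
    · simp only [Sym2.inf_mk, Sym2.sup_mk, h, inf_of_le_right, sup_of_le_left]
      exact Ideal.subset_span ⟨(i, j), rfl⟩

/-- The first and third monomials of `genBracket` become equal, and their constants `1` and `-1`
cancel. -/
theorem toSym_genBracket (i j k l : Fin n) : toSym n (genBracket i j k l) =
    (sgn i k + sgn j l) • (symY i l * symY k j) + (sgn i l + sgn j k) • (symY i k * symY j l) := by
  simp only [genBracket, map_add, map_smul, map_mul, toSym_X]
  rw [symY_comm k i, symY_comm l j]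
  module

theorem isPoissonIdeal_idealAlt : IsPoissonIdeal (bracket n) (idealAlt n) := by
  rw [← ker_toSym]
  refine isPoissonIdeal_ker_of_forall_X (isPoissonBracket_bracket n).toIsSkewBiderivation ker_toSym ?_
  rintro _ ⟨⟨i, j⟩, rfl⟩ ⟨k, l⟩
  rw [map_sub, LinearMap.sub_apply, bracket_X, bracket_X, map_sub, toSym_genBracket,
    toSym_genBracket, symY_comm k j, symY_comm k i, mul_comm (symY i l), mul_comm (symY j l)]
  module

theorem gyFormula_symY {br : SSym n →ₗ[ℂ] SSym n →ₗ[ℂ] SSym n}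
    (h : Lifts (toSym n) (bracket n) br) : GYFormula symY br := fun i j k l => by
  rw [← toSym_X, ← toSym_X k l, ← h.2, bracket_X, toSym_genBracket]

end Symmetric

/-! ### The quotient `S(Λ²V)`. -/

section Alternating

variable {n : ℕ}

theorem toAlt_X (i j : Fin n) : toAlt n (X i j) = altY i j := by simp [toAlt]

theorem altY_comm (i j : Fin n) : altY i j = -altY j i := by
  rcases lt_trichotomy i j with h | rfl | h
  · simp [altY, h, h.not_gt]
  · simp [altY]
  · simp [altY, h, h.not_gt]

/-- A section of the projection `S(V ⊗ V) → S(Λ²V)`. -/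
def altSection (n : ℕ) : SAlt n →ₐ[ℂ] SVV n :=
  MvPolynomial.aeval fun z => X z.1.1 z.1.2

theorem toAlt_comp_altSection : (toAlt n).comp (altSection n) = AlgHom.id ℂ _ := by
  refine MvPolynomial.algHom_ext fun z => ?_
  rw [AlgHom.comp_apply, altSection, MvPolynomial.aeval_X, toAlt_X, AlgHom.id_apply, altY,
    dif_pos z.2]

theorem ker_toAlt : RingHom.ker (toAlt n) = idealSym n := by
  refine ker_eq_of_section (s := altSection n) ?_ fun ⟨i, j⟩ => ?_
  · rw [idealSym, Ideal.span_le]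
    rintro _ ⟨p, rfl⟩
    simp only [SetLike.mem_coe, RingHom.mem_ker, map_add, toAlt_X, altY_comm p.1, neg_add_cancel]
  · have hgen (i j : Fin n) : X i j + X j i ∈ idealSym n := Ideal.subset_span ⟨(i, j), rfl⟩
    rw [toAlt_X, altY]
    split_ifs with h1 h2
    · simp [altSection]
    · simpa [altSection] using hgen i j
    · obtain rfl : i = j := le_antisymm (not_lt.1 h2) (not_lt.1 h1)
      -- On the diagonal the generator is `2 * X i i`, so `X i i` itself is obtained by halving.
      have h := Ideal.mul_mem_left _ (MvPolynomial.C (1 / 2)) (hgen i i)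
      rw [← two_mul, ← mul_assoc, show (2 : SVV n) = MvPolynomial.C 2 from rfl, ← map_mul] at h
      simpa using h

/-- The two signs from `Y k i` and `Y l j` cancel, so the symmetric and the skew-symmetric case
share one formula. -/
theorem toAlt_genBracket (i j k l : Fin n) : toAlt n (genBracket i j k l) =
    (sgn i k + sgn j l) • (altY i l * altY k j) + (sgn i l + sgn j k) • (altY i k * altY j l) := by
  simp only [genBracket, map_add, map_smul, map_mul, toAlt_X]
  rw [altY_comm k i, altY_comm l j, neg_mul_neg]
  module

theorem isPoissonIdeal_idealSym : IsPoissonIdeal (bracket n) (idealSym n) := by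
  rw [← ker_toAlt]
  refine isPoissonIdeal_ker_of_forall_X (isPoissonBracket_bracket n).toIsSkewBiderivation ker_toAlt ?_
  rintro _ ⟨⟨i, j⟩, rfl⟩ ⟨k, l⟩
  rw [map_add, LinearMap.add_apply, bracket_X, bracket_X, map_add, toAlt_genBracket,
    toAlt_genBracket, altY_comm k j, altY_comm k i, mul_neg, mul_neg, mul_comm (altY i l),
    mul_comm (altY j l)]
  module

theorem gyFormula_altY {br : SAlt n →ₗ[ℂ] SAlt n →ₗ[ℂ] SAlt n}
    (h : Lifts (toAlt n) (bracket n) br) : GYFormula altY br := fun i j k l => by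
  rw [← toAlt_X, ← toAlt_X k l, ← h.2, bracket_X, toAlt_genBracket]

end Alternating

end QuantumFolding

end

theorem corollary1p11 (n : ℕ) :
    ∃ br : QuantumFolding.SVV n →ₗ[ℂ] QuantumFolding.SVV n →ₗ[ℂ] QuantumFolding.SVV n,
      -- the formulae define a Poisson bracket on `S(V ⊗ V)`
      QuantumFolding.IsPoissonBracket br ∧
      QuantumFolding.QuadraticFormulae n br ∧
      (∀ br', QuantumFolding.IsSkewBiderivation br' → QuantumFolding.QuadraticFormulae n br' →
        br' = br) ∧
      -- it is the classical limit of the PBW algebra `S_q(V ⊗ V)`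
      (∀ {N : ℕ} (e : Fin N ≃ Fin n × Fin n), QuantumFolding.IsPBW e (QuantumFolding.x n)) ∧
      QuantumFolding.IsClassicalLimit (QuantumFolding.x n) br ∧
      -- it lifts the Goodearl-Yakimov bracket on `S(S²V) = S(V ⊗ V) / ⟨Λ²V⟩`
      (QuantumFolding.IsPoissonIdeal br (QuantumFolding.idealAlt n) ∧
        RingHom.ker (QuantumFolding.toSym n) = QuantumFolding.idealAlt n ∧
        ∃ brS, QuantumFolding.IsPoissonBracket brS ∧
          QuantumFolding.GYFormula QuantumFolding.symY brS ∧
          QuantumFolding.Lifts (QuantumFolding.toSym n) br brS) ∧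
      -- it lifts the Goodearl-Yakimov bracket on `S(Λ²V) = S(V ⊗ V) / ⟨S²V⟩`
      (QuantumFolding.IsPoissonIdeal br (QuantumFolding.idealSym n) ∧
        RingHom.ker (QuantumFolding.toAlt n) = QuantumFolding.idealSym n ∧
        ∃ brA, QuantumFolding.IsPoissonBracket brA ∧
          QuantumFolding.GYFormula QuantumFolding.altY brA ∧
          QuantumFolding.Lifts (QuantumFolding.toAlt n) br brA) := by
  have hP := QuantumFolding.isPoissonBracket_bracket n
  have hS := QuantumFolding.lifts_quotientBracket hP.toIsSkewBiderivation
    QuantumFolding.toSym_comp_symSection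
    (QuantumFolding.ker_toSym (n := n) ▸ QuantumFolding.isPoissonIdeal_idealAlt)
  have hA := QuantumFolding.lifts_quotientBracket hP.toIsSkewBiderivation
    QuantumFolding.toAlt_comp_altSection
    (QuantumFolding.ker_toAlt (n := n) ▸ QuantumFolding.isPoissonIdeal_idealSym)
  exact ⟨QuantumFolding.bracket n, hP, QuantumFolding.quadraticFormulae_bracket n,
    fun _ h h' => QuantumFolding.eq_bracket_of_quadraticFormulae h h',
    fun e => (QuantumFolding.isDeformation n).isPBW e,
    QuantumFolding.isClassicalLimit_bracket n,
    ⟨QuantumFolding.isPoissonIdeal_idealAlt, QuantumFolding.ker_toSym, _,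
      QuantumFolding.isPoissonBracket_of_lifts hP hS, QuantumFolding.gyFormula_symY hS, hS⟩,
    ⟨QuantumFolding.isPoissonIdeal_idealSym, QuantumFolding.ker_toAlt, _,
      QuantumFolding.isPoissonBracket_of_lifts hP hA, QuantumFolding.gyFormula_altY hA, hA⟩⟩
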